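/- Let $R$ be a finite commutative ring with identity. For a prime $p$ dividing $|R|$ let $R_p$ be the $p$-component of $R$, i.e. the subring (with its own identity) whose additive group is the Sylow $p$-subgroup of $R^+$. The ring $R$ is a CG-ring if each $R_p$ is a Galois ring, i.e. a finite local ring of characteristic $p^n$ ($p$ prime, $n\ge 1$) with radical $pR_p$. For $X\subseteq R$ put $\xi(X)=\sum_{x\in X}x\in\mathbb{Z}R^+$. An S-ring over $R$ is a subring $\mathcal{A}$ of the group ring $\mathbb{Z}R^+$ that has a $\mathbb{Z}$-basis $\{\xi(X): X\in\mathcal{S}\}$, where $\mathcal{S}=\mathcal{S}(\mathcal{A})$ is a partition of $R$ into non-empty sets (the basic sets) such that $\{0\}\in\mathcal{S}$, and $X\in\mathcal{S}$ implies $-X\in\mathcal{S}$ and $uX\in\mathcal{S}$ for every unit $u\in R^\times$. It is dense if every ideal of $R$ is a union of basic sets. A non-empty set $X\subseteq R$ is pure if $0$ is the only ideal $I$ of $R$ with $X+I=X$; the S-ring $\mathcal{A}$ is pure if every basic set $X\in\mathcal{S}(\mathcal{A})$ with $X\cap R^\times\neq\emptyset$ is pure. For a subgroup $K\le R^\times$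 let $\mathrm{cyc}(K,R)$ be the S-ring over $R$ whose basic sets are the orbits of $K$ acting on $R$ by multiplication. Theorem. Let $R$ be a CG-ring of odd characteristic and let $\mathcal{A}$ be a dense pure S-ring over $R$. Then $\mathcal{A}$ is cyclotomic; more precisely, $\mathcal{A}=\mathrm{cyc}(K,R)$ for some subgroup $K\le R^\times$ that is pure (as a subset of $R$). -/

import Mathlib

open scoped Pointwise

/-! ### Schur rings over finite groups (written additively) -/

/-- The element `ξ(X) = ∑_{x ∈ X} x` of the integral group ring of a finite group `G`. -/
noncomputable def groupRingSum {G : Type*} [Finite G] (X : Set G) : AddMonoidAlgebra ℤ G :=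
  ∑ x ∈ (Set.toFinite X).toFinset, AddMonoidAlgebra.single x (1 : ℤ)

/-- A Schur ring (S-ring) over a finite (additively written) group `G`: a subring of the group
ring `ℤG` having a `ℤ`-basis `ξ(X)`, `X ∈ basicSets`, where `basicSets` is a partition of `G` into
non-empty sets which contains `{0}` and is closed under negation. The family `basicSets` is
uniquely determined by the subring. -/
structure SchurRing (G : Type*) [AddGroup G] [Finite G] extends
    Subring (AddMonoidAlgebra ℤ G) where
  /-- The family `S(A)` of basic sets. -/
  basicSets : Set (Set G)
  nonempty_of_mem : ∀ X ∈ basicSets, X.Nonempty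
  pairwiseDisjoint : basicSets.PairwiseDisjoint id
  zero_mem_basicSets : {0} ∈ basicSets
  sUnion_basicSets : ⋃₀ basicSets = Set.univ
  neg_mem_basicSets : ∀ X ∈ basicSets, -X ∈ basicSets
  linearIndepOn : LinearIndepOn ℤ groupRingSum basicSets
  span_eq : (Submodule.span ℤ (groupRingSum '' basicSets) : Set (AddMonoidAlgebra ℤ G)) = carrier

namespace SchurRing

/-- `A`-sets: unions of basic sets of `A`. -/
def IsASet {G : Type*} [AddGroup G] [Finite G] (A : SchurRing G) (X : Set G) : Prop :=
  ∃ T ⊆ A.basicSets, X = ⋃₀ T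

/-- An S-ring over the additive group of `R` is an S-ring over the ring `R` if it is invariant
under multiplication by the units of `R`. -/
def IsOverRing {R : Type*} [CommRing R] [Finite R] (A : SchurRing R) : Prop :=
  ∀ (u : Rˣ), ∀ X ∈ A.basicSets, u • X ∈ A.basicSets

/-- `A` is dense if every ideal of `R` is an `A`-ideal. -/
def IsDense {R : Type*} [CommRing R] [Finite R] (A : SchurRing R) : Prop :=
  ∀ I : Ideal R, A.IsASet (I : Set R)

end SchurRing

/-! ### Purity -/

/-- `I_L(X)`: the largest ideal `I` of `R` such that `X + I = X`
(see `isGreatest_lowerIdeal`). -/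
def lowerIdeal {R : Type*} [CommRing R] (X : Set R) : Ideal R :=
  sSup {I : Ideal R | X + (I : Set R) = X}

theorem isGreatest_lowerIdeal {R : Type*} [CommRing R] (X : Set R) :
    IsGreatest {I : Ideal R | X + (I : Set R) = X} (lowerIdeal X) := by
  refine ⟨?_, fun I hI => le_sSup hI⟩
  let J : Ideal R :=
    { carrier := {r | ∀ s, ∀ x ∈ X, x + s * r ∈ X}
      add_mem' := by
        intro a b ha hb s x hx
        have := hb s _ (ha s x hx)
        rwa [add_assoc, ← mul_add] at this
      zero_mem' := by
        intro s x hx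
        simpa using hx
      smul_mem' := by
        intro c a ha s x hx
        have := ha (s * c) x hx
        rwa [mul_assoc] at this }
  have hle : lowerIdeal X ≤ J := by
    refine sSup_le fun I hI r hr s x hx => ?_
    have h : x + s * r ∈ X + (I : Set R) := Set.add_mem_add hx (I.mul_mem_left s hr)
    rwa [show X + (I : Set R) = X from hI] at h
  refine Set.Subset.antisymm ?_ fun x hx => ⟨x, hx, 0, zero_mem _, add_zero x⟩
  rintro _ ⟨x, hx, r, hr, rfl⟩
  simpa using hle hr 1 x hx

/-- A non-empty set `X ⊆ R` is pure if `I_L(X) = 0`. -/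
def IsPureSet {R : Type*} [CommRing R] (X : Set R) : Prop :=
  X.Nonempty ∧ lowerIdeal X = ⊥

/-- An S-ring over `R` is pure if `I_L(X) = 0` for its basic sets `X` meeting `Rˣ` (the ideal
`I_L(X)` is the same for all of them). -/
def SchurRing.IsPure {R : Type*} [CommRing R] [Finite R] (A : SchurRing R) : Prop :=
  ∀ X ∈ A.basicSets, (∃ u : Rˣ, (u : R) ∈ X) → IsPureSet X

/-- A subgroup of `Rˣ` is pure if it is pure as a subset of `R`. -/
def IsPureSubgroup {R : Type*} [CommRing R] (K : Subgroup Rˣ) : Prop :=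
  IsPureSet (Units.val '' (K : Set Rˣ))

/-! ### Galois rings and CG-rings -/

/-- A finite local ring of characteristic `p ^ n` (`p` prime, `n ≥ 1`) is a Galois ring if its
radical is generated by `p`. -/
def IsGaloisRing (S : Type*) [CommRing S] : Prop :=
  Finite S ∧ IsLocalRing S ∧ ∃ p n : ℕ, p.Prime ∧ 1 ≤ n ∧ ringChar S = p ^ n ∧
    Ring.jacobson S = Ideal.span {(p : S)}

/-- The `p`-component `R_p` of `R`: the elements of `R` whose additive order is a power of `p`,
that is, the Sylow `p`-subgroup of the additive group of a finite ring `R`. -/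
def pComponent (R : Type*) [CommRing R] (p : ℕ) : NonUnitalSubring R where
  carrier := {x | ∃ k : ℕ, (p ^ k) • x = 0}
  add_mem' := by
    rintro a b ⟨k, hk⟩ ⟨l, hl⟩
    refine ⟨k + l, ?_⟩
    rw [smul_add, pow_add, mul_comm, mul_smul, hk, mul_comm, mul_smul, hl]
    simp
  zero_mem' := ⟨0, by simp⟩
  neg_mem' := by
    rintro a ⟨k, hk⟩
    exact ⟨k, by rw [smul_neg, hk, neg_zero]⟩
  mul_mem' := by
    rintro a b ⟨k, hk⟩ _
    exact ⟨k, by rw [← smul_mul_assoc, hk, zero_mul]⟩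

theorem exists_one_pComponent (R : Type*) [CommRing R] [Finite R] (p : ℕ) [hp : Fact p.Prime] :
    ∃ e ∈ pComponent R p, ∀ x ∈ pComponent R p, e * x = x := by
  obtain ⟨k, m, hm, hN⟩ := Nat.exists_eq_pow_mul_and_not_dvd
    (Nat.card_pos (α := R)).ne' p hp.out.ne_one
  have hcop : ∀ j, IsCoprime ((p ^ j : ℕ) : ℤ) (m : ℤ) := fun j =>
    Nat.isCoprime_iff_coprime.2 (Nat.Coprime.pow_left _ ((Nat.Prime.coprime_iff_not_dvd hp.out).2 hm))
  obtain ⟨a, b, hab⟩ := hcop k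
  have habR : (a : R) * (p : R) ^ k + b * m = 1 := by exact_mod_cast congrArg (Int.cast : ℤ → R) hab
  have hcard : ((p : R) ^ k * m) = 0 := by
    have h : ((Nat.card R : ℕ) : R) = 0 := by
      rw [← nsmul_one]
      exact card_nsmul_eq_zero'
    rw [hN] at h
    exact_mod_cast h
  refine ⟨(b : R) * m, ⟨k, ?_⟩, ?_⟩
  · rw [nsmul_eq_mul]
    push_cast
    linear_combination (b : R) * hcard
  · rintro x ⟨j, hj⟩
    rw [nsmul_eq_mul] at hj
    push_cast at hj
    obtain ⟨c, d, hcd⟩ := hcop j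
    have hcdR : (c : R) * (p : R) ^ j + d * m = 1 := by
      exact_mod_cast congrArg (Int.cast : ℤ → R) hcd
    have h1 : x = d * m * x := by linear_combination (-x) * hcdR + (c : R) * hj
    have h2 : (p : R) ^ k * x = 0 := by
      rw [h1]
      linear_combination (d : R) * x * hcard
    linear_combination x * habR - (a : R) * h2

/-- The `p`-component of a finite ring, with the operations of `R`, is a commutative ring with an
identity of its own. -/
noncomputable instance pComponentCommRing (R : Type*) [CommRing R] [Finite R] (p : ℕ)
    [Fact p.Prime] : CommRing (pComponent R p) :=
  { (inferInstance : NonUnitalCommRing (pComponent R p)) with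
    one := ⟨(exists_one_pComponent R p).choose, (exists_one_pComponent R p).choose_spec.1⟩
    one_mul := fun x => Subtype.ext ((exists_one_pComponent R p).choose_spec.2 x x.2)
    mul_one := fun x => Subtype.ext
      ((mul_comm _ _).trans ((exists_one_pComponent R p).choose_spec.2 x x.2)) }

/-- A finite commutative ring is a CG-ring (componentwise Galois ring) if its `p`-component is a
Galois ring for every prime `p` dividing its order. -/
def IsCGRing (R : Type*) [CommRing R] [Finite R] : Prop :=
  ∀ (p : ℕ) [Fact p.Prime], p ∣ Nat.card R → IsGaloisRing (pComponent R p)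

/-! ### Cyclotomic S-rings -/

/-- The set of orbits of `K ≤ Rˣ` on `R`. -/
def unitOrbits {R : Type*} [CommRing R] (K : Subgroup Rˣ) : Set (Set R) :=
  Set.range fun r : R => MulAction.orbit K r

theorem coeff_groupRingSum {G : Type*} [Finite G] (X : Set G) (x : G) [Decidable (x ∈ X)] :
    (groupRingSum X).coeff x = if x ∈ X then 1 else 0 := by
  classical
  simp only [groupRingSum, AddMonoidAlgebra.coeff_sum, Finsupp.finsetSum_apply,
    AddMonoidAlgebra.coeff_single, Finsupp.single_apply]
  simp

theorem mem_span_unitOrbits_iff {R : Type*} [CommRing R] [Finite R] (K : Subgroup Rˣ)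
    (a : AddMonoidAlgebra ℤ R) :
    a ∈ Submodule.span ℤ (groupRingSum '' unitOrbits K) ↔
      ∀ (k : K) (x : R), a.coeff (k • x) = a.coeff x := by
  classical
  constructor
  · intro ha k x
    induction ha using Submodule.span_induction with
    | mem a h =>
      obtain ⟨_, ⟨r, rfl⟩, rfl⟩ := h
      have hiff : k • x ∈ MulAction.orbit K r ↔ x ∈ MulAction.orbit K r := by
        rw [← MulAction.orbit_eq_iff, MulAction.orbit_smul, MulAction.orbit_eq_iff]
      simp only [coeff_groupRingSum, hiff]
    | zero => simp
    | add a b _ _ h1 h2 => simp [h1, h2]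
    | smul c a _ h => simp only [AddMonoidAlgebra.coeff_smul, Finsupp.smul_apply, h]
  · intro ha
    have hc : ∀ X ∈ unitOrbits K, ∃ c : ℤ, ∀ x ∈ X, a.coeff x = c := by
      rintro _ ⟨r, rfl⟩
      refine ⟨a.coeff r, ?_⟩
      rintro _ ⟨k, rfl⟩
      exact ha k r
    choose! c hc using hc
    have key : a = ∑ X ∈ (Set.toFinite (unitOrbits K)).toFinset, c X • groupRingSum X := by
      ext x
      simp only [AddMonoidAlgebra.coeff_sum, Finsupp.finsetSum_apply,
        AddMonoidAlgebra.coeff_smul, Finsupp.smul_apply, coeff_groupRingSum]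
      rw [Finset.sum_eq_single (MulAction.orbit K x)]
      · rw [if_pos (MulAction.mem_orbit_self x),
          hc (MulAction.orbit K x) (Set.mem_range_self x) x (MulAction.mem_orbit_self x)]
        simp
      · intro X hX hne
        obtain ⟨r, rfl⟩ := (Set.Finite.mem_toFinset _).1 hX
        rw [if_neg, smul_zero]
        exact fun hx => hne (MulAction.orbit_eq_iff.2 hx).symm
      · intro h
        exact absurd ((Set.Finite.mem_toFinset _).2 (Set.mem_range_self x)) h
    rw [key]
    refine Submodule.sum_mem _ fun X hX => Submodule.smul_mem _ _ (Submodule.subset_span ?_)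
    exact ⟨X, (Set.Finite.mem_toFinset _).1 hX, rfl⟩

theorem mem_span_unitOrbits_iff_map {R : Type*} [CommRing R] [Finite R] (K : Subgroup Rˣ)
    (a : AddMonoidAlgebra ℤ R) :
    a ∈ Submodule.span ℤ (groupRingSum '' unitOrbits K) ↔
      ∀ k : K, AddMonoidAlgebra.mapDomainRingHom ℤ (DistribSMul.toAddMonoidHom R k) a = a := by
  have h : ∀ (k : K) (x : R),
      (AddMonoidAlgebra.mapDomainRingHom ℤ (DistribSMul.toAddMonoidHom R k) a).coeff (k • x)
        = a.coeff x := by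
    intro k x
    exact Finsupp.mapDomain_apply (MulAction.injective k) _ x
  rw [mem_span_unitOrbits_iff]
  refine forall_congr' fun k => ⟨fun ha => ?_, fun ha x => ?_⟩
  · ext x
    have := h k (k⁻¹ • x)
    rw [smul_inv_smul] at this
    rw [this, ← ha (k⁻¹ • x), smul_inv_smul]
  · rw [← h k x, ha]

/-- The cyclotomic S-ring `cyc(K, R)`: the span of the elements `ξ(X)`, where `X` runs over the
orbits of `K ≤ Rˣ` on `R`. -/
noncomputable def cyc {R : Type*} [CommRing R] [Finite R] (K : Subgroup Rˣ) : SchurRing R where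
  carrier := Submodule.span ℤ (groupRingSum '' unitOrbits K)
  mul_mem' := by
    intro a b ha hb
    simp only [SetLike.mem_coe, mem_span_unitOrbits_iff_map] at ha hb ⊢
    intro k
    rw [map_mul, ha, hb]
  one_mem' := by
    simp only [SetLike.mem_coe, mem_span_unitOrbits_iff_map]
    exact fun k => map_one _
  add_mem' := fun ha hb => Submodule.add_mem _ ha hb
  zero_mem' := Submodule.zero_mem _
  neg_mem' := fun ha => Submodule.neg_mem _ ha
  basicSets := unitOrbits K
  nonempty_of_mem := by
    rintro _ ⟨r, rfl⟩
    exact MulAction.nonempty_orbit r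
  pairwiseDisjoint := by
    rintro _ ⟨r, rfl⟩ _ ⟨s, rfl⟩ h
    exact (MulAction.orbit.eq_or_disjoint r s).resolve_left h
  zero_mem_basicSets := by
    refine ⟨0, Set.ext fun x => ?_⟩
    simp [MulAction.mem_orbit_iff, eq_comm]
  sUnion_basicSets := by
    refine Set.eq_univ_of_forall fun x => ?_
    exact ⟨_, ⟨x, rfl⟩, MulAction.mem_orbit_self x⟩
  neg_mem_basicSets := by
    rintro _ ⟨r, rfl⟩
    refine ⟨-r, Set.ext fun x => ?_⟩
    simp only [Set.mem_neg, MulAction.mem_orbit_iff, smul_neg, neg_eq_iff_eq_neg]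
  linearIndepOn := by
    classical
    rw [linearIndepOn_iff']
    intro t g ht h X hX
    obtain ⟨r, rfl⟩ := ht hX
    have h1 := congrArg (fun a => a.coeff r) h
    simp only [AddMonoidAlgebra.coeff_sum, Finsupp.finsetSum_apply,
      AddMonoidAlgebra.coeff_smul, Finsupp.smul_apply, coeff_groupRingSum] at h1
    rw [Finset.sum_eq_single_of_mem _ hX] at h1
    · simpa using h1
    · intro Y hY hne
      obtain ⟨s, rfl⟩ := ht hY
      rw [if_neg, smul_zero]
      exact fun hx => hne (MulAction.orbit_eq_iff.2 hx).symm
  span_eq := rfl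

/-! ### Powers of one-units -/

/-! By density the basic set of 1 consists of units, hence is a subgroup `K` of `Rˣ`, and it is pure
by hypothesis. It has to be shown that every basic set is a `K`-orbit. A primitive character
identifies `R` with its character group, so one can also consider the dual class of 1: the elements
that transforms of class functions do not separate from 1. By density it too is a group of units.

The core is a rigidity statement, `GaloisDecomposition.mul_mem_orbit_of_charTransform_eq`. Let all
components of `r` be non-zero, `L r ⊆ K r`, and let `φ` have support exactly `L r`. If the transform
of `φ` agrees at `x` and `u x` for all units `x`, then `u r ∈ L r`. Otherwise `F y = φ y - φ (u⁻¹
y)` is non-zero at `r`, while its transform vanishes on units. Thus `F` combines only characters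
trivial on some minimal ideal, and its alternating sums over cubes with edges in the minimal ideals
vanish (`sum_cube_eq_zero`). So `F` is non-zero at another vertex of each such cube based at `r`.
Purity of `K` provides edges leaving `K r` (`exists_socle_add_notMem`); modulo the units preserving
`L r` they become elements of distinct odd prime orders. Doubling one edge then gives incompatible
expressions for `u`.

Rigidity is applied four times. With the indicator of `K`, then with that of the dual class, it
shows that `K` is the dual class of 1. With the push-forward of the indicator of `K` under
multiplication by `r`, then with the indicator of the basic set of `r`, it shows that this basic set
is `K r` when all components of `r` are non-zero. Density transfers the result to the remaining `r`
by projection. -/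

theorem exists_one_add_pow_eq {R : Type*} [CommRing R] (a : R) (n : ℕ) :
    ∃ c, (1 + a) ^ n = 1 + n * a + n.choose 2 * a ^ 2 + a ^ 3 * c := by
  induction n with
  | zero => exact ⟨0, by simp⟩
  | succ n ih =>
    obtain ⟨c, hc⟩ := ih
    refine ⟨c + c * a + n.choose 2, ?_⟩
    rw [pow_succ, hc, Nat.choose_succ_succ' n 1, Nat.choose_one_right]
    push_cast
    ring

/-- Oddness enters here: `p` divides the binomial coefficient `p.choose 2` only for `p > 2`, and
this puts the quadratic term into the error factor. -/
theorem exists_one_add_pow_prime_eq {R : Type*} [CommRing R] {p : ℕ} (hp : p.Prime) (hodd : Odd p)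
    (b : R) : ∃ c, (1 + p * b) ^ p = 1 + p * (p * b) * (1 + p * c) := by
  obtain ⟨c, hc⟩ := exists_one_add_pow_eq ((p : R) * b) p
  have h2 : 2 < p := lt_of_le_of_ne hp.two_le (by rintro rfl; exact absurd hodd (by decide))
  obtain ⟨m, hm⟩ := hp.dvd_choose_self two_ne_zero h2
  refine ⟨m * b + c * b ^ 2, ?_⟩
  rw [hc, hm]
  push_cast
  ring

/-- For an odd prime `p` and `p ∣ a`, the power `(1 + a) ^ p ^ j` is `1 + p ^ j * a` up to a
factor `1 + p * c` of the second summand. -/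
theorem exists_one_add_pow_prime_pow_eq {R : Type*} [CommRing R] {p : ℕ} (hp : p.Prime)
    (hodd : Odd p) (b : R) (j : ℕ) :
    ∃ c, (1 + p * b) ^ p ^ j = 1 + p ^ j * (p * b) * (1 + p * c) := by
  induction j with
  | zero => exact ⟨0, by simp⟩
  | succ j ih =>
    obtain ⟨c, hc⟩ := ih
    obtain ⟨d, hd⟩ := exists_one_add_pow_prime_eq hp hodd ((p : R) ^ j * b * (1 + p * c))
    refine ⟨c + d + p * c * d, ?_⟩
    rw [pow_succ p j, pow_mul, hc,
      show (p : R) ^ j * (p * b) * (1 + p * c) = p * (p ^ j * b * (1 + p * c)) by ring, hd]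
    ring

theorem one_add_pow_of_sq_eq_zero {R : Type*} [CommRing R] {a : R} (ha : a * a = 0) (n : ℕ) :
    (1 + a) ^ n = 1 + n * a := by
  obtain ⟨c, hc⟩ := exists_one_add_pow_eq a n
  rw [hc]
  linear_combination ((n.choose 2 : R) + a * c) * ha

theorem idempotent_mul_pow {R : Type*} [CommRing R] {e : R} (he : e * e = e) (x : R) (n : ℕ) :
    e * (e * x) ^ n = e * x ^ n := by
  rw [mul_pow, ← mul_assoc, ← pow_succ', (show IsIdempotentElem e from he).pow_succ_eq]

theorem idempotent_mul_pow_congr {R : Type*} [CommRing R] {e x y : R} (he : e * e = e)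
    (h : e * x = e * y) (n : ℕ) : e * x ^ n = e * y ^ n := by
  rw [← idempotent_mul_pow he, h, idempotent_mul_pow he]

/-! ### Products of Galois rings -/

/-- A decomposition of the ring `R` into a product of Galois rings of coprime odd characteristics,
given by idempotents `e i`; the residue characteristic of the component `e i * R` is `p i`. -/
structure GaloisDecomposition {R : Type*} [CommRing R] {ι : Type*} [Fintype ι] (p : ι → ℕ)
    (e : ι → R) : Prop where
  complete : CompleteOrthogonalIdempotents e
  injective : Function.Injective p
  prime : ∀ i, (p i).Prime
  odd : ∀ i, Odd (p i)
  ne_zero : ∀ i, e i ≠ 0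
  exists_pow_mul : ∀ i, ∃ n : ℕ, (p i : R) ^ n * e i = 0
  unit_or : ∀ i x, (∃ y, x * y * e i = e i) ∨ ∃ y, e i * x = p i * y * e i

/-- The elements of the minimal ideal of the component `e * R` of residue characteristic `p`. -/
def socle {R : Type*} [CommRing R] (p : ℕ) (e : R) : Set R := {x | e * x = x ∧ p * x = 0}

namespace GaloisDecomposition

variable {R : Type*} [CommRing R] {ι : Type*} [Fintype ι] {p : ι → ℕ} {e : ι → R}

theorem idem (h : GaloisDecomposition p e) (i : ι) : e i * e i = e i := h.complete.idem i

theorem ortho_mul (h : GaloisDecomposition p e) {i j : ι} (hij : i ≠ j) : e i * e j = 0 :=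
  h.complete.ortho hij

theorem mul_one_ne_zero (h : GaloisDecomposition p e) (i : ι) : e i * 1 ≠ 0 := by
  rw [mul_one]
  exact h.ne_zero i

theorem ext (h : GaloisDecomposition p e) {x y : R} (hxy : ∀ i, e i * x = e i * y) : x = y := by
  rw [← one_mul x, ← one_mul y, ← h.complete.complete, Finset.sum_mul, Finset.sum_mul]
  exact Finset.sum_congr rfl fun i _ => hxy i

theorem mul_sum (h : GaloisDecomposition p e) (f : ι → R) (i : ι) :
    e i * ∑ j, e j * f j = e i * f i := by
  rw [Finset.mul_sum, Finset.sum_eq_single i]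
  · rw [← mul_assoc, h.idem]
  · intro j _ hj
    rw [← mul_assoc, h.ortho_mul hj.symm, zero_mul]
  · simp

theorem mul_socle_eq_zero (h : GaloisDecomposition p e) {i j : ι} (hij : i ≠ j) {x : R}
    (hx : x ∈ socle (p i) (e i)) : e j * x = 0 := by
  rw [← hx.1, ← mul_assoc, h.ortho_mul hij.symm, zero_mul]

/-- Every element of a component is a power of `p` times a unit of the component, or zero. -/
theorem exists_eq_pow_mul (h : GaloisDecomposition p e) (i : ι) {x : R} (hx : e i * x ≠ 0) :
    ∃ (j : ℕ) (a b : R), e i * x = p i ^ j * a * e i ∧ a * b * e i = e i := by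
  have key : ∀ m : ℕ, (∃ (j : ℕ) (a b : R), e i * x = p i ^ j * a * e i ∧ a * b * e i = e i) ∨
      ∃ y, e i * x = p i ^ m * y * e i := by
    intro m
    induction m with
    | zero => exact Or.inr ⟨x, by ring⟩
    | succ m ih =>
      obtain ih | ⟨y, hy⟩ := ih
      · exact Or.inl ih
      · obtain ⟨z, hz⟩ | ⟨z, hz⟩ := h.unit_or i y
        · exact Or.inl ⟨m, y, z, hy, hz⟩
        · exact Or.inr ⟨z, by rw [hy]; linear_combination (p i : R) ^ m * hz⟩
  obtain ⟨n, hn⟩ := h.exists_pow_mul i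
  obtain h1 | ⟨y, hy⟩ := key n
  · exact h1
  · exact absurd (by rw [hy]; linear_combination y * hn) hx

theorem exists_socle_ne_zero (h : GaloisDecomposition p e) (i : ι) :
    ∃ x ∈ socle (p i) (e i), x ≠ 0 := by
  classical
  have hex := h.exists_pow_mul i
  obtain ⟨m, hm⟩ : ∃ m, Nat.find hex = m + 1 := by
    refine Nat.exists_eq_succ_of_ne_zero fun h0 => h.ne_zero i ?_
    have := Nat.find_spec hex
    rwa [h0, pow_zero, one_mul] at this
  refine ⟨(p i : R) ^ m * e i, ⟨?_, ?_⟩, Nat.find_min hex (by omega)⟩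
  · linear_combination (p i : R) ^ m * h.idem i
  · have := Nat.find_spec hex
    rw [hm] at this
    linear_combination this

/-- The minimal ideal of a component is contained in every non-zero ideal of it. -/
theorem exists_mul_eq_of_mem_socle (h : GaloisDecomposition p e) {i : ι} {r x : R}
    (hx : x ∈ socle (p i) (e i)) (hr : e i * r ≠ 0) : ∃ c, c * r = x ∧ e i * c = c := by
  obtain rfl | hx0 := eq_or_ne x 0
  · exact ⟨0, by simp, by simp⟩
  obtain ⟨j, a, b, hj, hab⟩ := h.exists_eq_pow_mul i hr
  obtain ⟨k, c, d, hk, hcd⟩ := h.exists_eq_pow_mul i (x := x) (by rwa [hx.1])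
  have hjk : j ≤ k := by
    by_contra! hlt
    refine hr ?_
    have h1 : (p i : R) ^ (k + 1) * e i = 0 := by
      have h2 : (p i : R) * (p i ^ k * c * e i) = 0 := by rw [← hk, hx.1, hx.2]
      linear_combination d * h2 - (p i : R) ^ (k + 1) * hcd
    obtain ⟨l, rfl⟩ := Nat.exists_eq_add_of_lt hlt
    rw [hj]
    linear_combination (p i : R) ^ l * a * h1
  obtain ⟨l, rfl⟩ := Nat.exists_eq_add_of_le hjk
  refine ⟨p i ^ l * c * b * e i, ?_, ?_⟩
  · rw [← hx.1, hk]
    linear_combination (p i : R) ^ l * c * b * hj + (p i : R) ^ (l + j) * c * hab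
  · linear_combination (p i : R) ^ l * c * b * h.idem i

/-- A non-unit has a component divisible by `p i`, and `p i` annihilates the minimal ideal. -/
theorem isUnit_or_socle (h : GaloisDecomposition p e) (x : R) :
    IsUnit x ∨ ∃ i, ∀ y ∈ socle (p i) (e i), x * y = 0 := by
  by_cases hx : ∀ i, ∃ y, x * y * e i = e i
  · choose y hy using hx
    refine Or.inl (IsUnit.of_mul_eq_one (∑ i, e i * y i) (h.ext fun i => ?_))
    rw [mul_left_comm, h.mul_sum]
    linear_combination hy i
  · push Not at hx
    obtain ⟨i, hi⟩ := hx
    obtain ⟨y, hy⟩ | ⟨y, hy⟩ := h.unit_or i x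
    · exact absurd hy (hi y)
    · refine Or.inr ⟨i, fun z hz => ?_⟩
      rw [← hz.1]
      linear_combination z * hy + y * e i * hz.2

/-- Every non-zero ideal contains one of the minimal ideals, so it suffices that the character be
non-trivial on each of these; such a character is assembled componentwise. -/
theorem exists_primitive_addChar (h : GaloisDecomposition p e) [Finite R] :
    ∃ χ : AddChar R ℂ, χ.IsPrimitive := by
  classical
  choose s hs hs0 using h.exists_socle_ne_zero
  have hψ : ∀ i, ∃ ψ : AddChar R ℂ, ψ (s i) ≠ 1 := fun i =>
    AddChar.exists_apply_ne_zero.2 (hs0 i)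
  choose ψ hψ using hψ
  refine ⟨∏ i, (ψ i).mulShift (e i), fun a ha h1 => ?_⟩
  obtain ⟨i, hi⟩ : ∃ i, e i * a ≠ 0 := by
    by_contra! hall
    exact ha (h.ext fun i => by rw [hall, mul_zero])
  obtain ⟨c, hc, -⟩ := h.exists_mul_eq_of_mem_socle (hs i) hi
  refine hψ i ?_
  have h2 := DFunLike.congr_fun h1 c
  rw [AddChar.mulShift_apply, mul_comm, hc, AddChar.prod_apply, Finset.prod_eq_single i] at h2
  · simpa [AddChar.mulShift_apply, (hs i).1] using h2
  · intro j _ hj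
    rw [AddChar.mulShift_apply, h.mul_socle_eq_zero hj.symm (hs i), AddChar.map_zero_eq_one]
  · simp

end GaloisDecomposition

/-! ### Purity and translation of orbits by minimal ideals -/

namespace GaloisDecomposition

variable {R : Type*} [CommRing R] {ι : Type*} [Fintype ι] {p : ι → ℕ} {e : ι → R}

theorem mul_self_eq_zero_of_mem_socle (h : GaloisDecomposition p e) {i : ι} {r x : R}
    (hr : p i * (e i * r) ≠ 0) (hx : x ∈ socle (p i) (e i)) : x * x = 0 := by
  obtain ⟨c, hc, -⟩ := h.exists_mul_eq_of_mem_socle (r := p i * r) hx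
    (by rwa [mul_left_comm])
  linear_combination -x * hc + c * r * hx.2

/-- If the orbit `K r` contains `r + x` for all `x` in a minimal ideal, and the corresponding
component of `r` does not lie in that ideal, then `K` contains all the `1 + x`. -/
theorem exists_mem_eq_one_add (h : GaloisDecomposition p e) {K : Subgroup Rˣ} {r : R}
    (hr : ∀ i, e i * r ≠ 0) {i : ι} (hi : p i * (e i * r) ≠ 0)
    (hK : ∀ x ∈ socle (p i) (e i), ∃ k ∈ K, (k : R) * r = r + x) {x : R}
    (hx : x ∈ socle (p i) (e i)) : ∃ k ∈ K, (k : R) = 1 + x := by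
  classical
  obtain ⟨j, a, b, hj, hab⟩ := h.exists_eq_pow_mul i (hr i)
  choose n hn using h.exists_pow_mul
  -- Translating by `a * x` instead of `x` lets the unit part `a` of `e i * r` cancel, leaving `p ^
  -- j * (k - 1) = x` in the component.
  obtain ⟨k, hk, hkr⟩ := hK (a * x)
    ⟨by linear_combination a * hx.1, by linear_combination a * hx.2⟩
  -- A power of `k` with exponent `p i ^ j * M ^ (p i - 1)` will be taken. The first factor gives `1
  -- + x` in component `i`; the second is 1 modulo `p i`, so keeps `1 + x`, and makes all other
  -- components trivial.
  set M : ℕ := ∏ l ∈ Finset.univ.erase i, p l ^ n l with hM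
  have hMp : (p i).Coprime M := by
    refine Nat.Coprime.prod_right fun l hl => Nat.Coprime.pow_right _ ?_
    exact (Nat.coprime_primes (h.prime i) (h.prime l)).2
      (h.injective.ne (Finset.ne_of_mem_erase hl).symm)
  have hM1 : M ^ (p i - 1) ≡ 1 [MOD p i] := by
    have := Nat.ModEq.pow_totient (Nat.coprime_comm.1 hMp)
    rwa [Nat.totient_prime (h.prime i)] at this
  have hMx : ((M ^ (p i - 1) : ℕ) : R) * x = x := by
    obtain ⟨c, hc⟩ := (Nat.modEq_iff_dvd.1 hM1.symm)
    have h2 : ((M ^ (p i - 1) : ℕ) : R) - 1 = p i * c := by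
      exact_mod_cast congrArg (Int.cast : ℤ → R) hc
    linear_combination x * h2 + (c : R) * hx.2
  have hx2 : x * x = 0 := h.mul_self_eq_zero_of_mem_socle hi hx
  have hsub : ((k : R) - 1) * r = a * x := by linear_combination hkr
  -- the component with index `i`
  have hpj : (p i : R) ^ j * ((k : R) - 1) * e i = x := by
    linear_combination (-b) * ((k : R) - 1) * hj + b * e i * hsub
      - (p i : R) ^ j * ((k : R) - 1) * hab + x * hab + hx.1
  have hki : e i * (k : R) ^ p i ^ j = e i * (1 + x) := by
    -- Were `k - 1` invertible in component `i`, then `e i * r` would be a multiple of `x`, hence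
    -- killed by `p i`, against `hi`.
    obtain ⟨y, hy⟩ | ⟨y, hy⟩ := h.unit_or i ((k : R) - 1)
    · refine absurd ?_ hi
      linear_combination (-(p i : R) * r) * hy + (p i : R) * y * e i * hsub + y * a * e i * hx.2
    · obtain ⟨c, hc⟩ := exists_one_add_pow_prime_pow_eq (h.prime i) (h.odd i) y j
      rw [idempotent_mul_pow_congr (h.idem i) (y := 1 + p i * y)
        (by linear_combination hy), hc]
      linear_combination (1 + (p i : R) * c) * (-(p i : R) ^ j * hy + hpj) + c * hx.2 - hx.1
  refine ⟨k ^ (p i ^ j * M ^ (p i - 1)), K.pow_mem hk _, h.ext fun l => ?_⟩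
  rw [Units.val_pow_eq_pow_val, pow_mul]
  obtain rfl | hl := eq_or_ne l i
  · rw [idempotent_mul_pow_congr (h.idem l) hki, one_add_pow_of_sq_eq_zero hx2, hMx]
  · rw [mul_add, h.mul_socle_eq_zero hl.symm hx, add_zero, mul_one, ← pow_mul]
    obtain ⟨m, hm⟩ : p l ^ n l ∣ p i ^ j * M ^ (p i - 1) := by
      refine Dvd.dvd.mul_left (dvd_pow ?_ ?_) _
      · exact Finset.dvd_prod_of_mem _ (Finset.mem_erase.2 ⟨hl, Finset.mem_univ _⟩)
      · have := (h.prime i).two_le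
        omega
    rw [hm, pow_mul]
    suffices hs : e l * (k : R) ^ p l ^ n l = e l * 1 by
      rw [idempotent_mul_pow_congr (h.idem l) hs, one_pow, mul_one]
    have h0 : e l * (a * x) = 0 := by
      rw [mul_left_comm, h.mul_socle_eq_zero hl.symm hx, mul_zero]
    -- Here `k - 1` annihilates the non-zero component of `r`, so it is divisible by `p l`.
    obtain ⟨y, hy⟩ | ⟨y, hy⟩ := h.unit_or l ((k : R) - 1)
    · refine absurd ?_ (hr l)
      linear_combination (-r) * hy + y * e l * hsub + y * h0
    · obtain ⟨c, hc⟩ := exists_one_add_pow_prime_pow_eq (h.prime l) (h.odd l) y (n l)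
      rw [idempotent_mul_pow_congr (h.idem l) (y := 1 + p l * y)
        (by linear_combination hy), hc]
      linear_combination (p l : R) * y * (1 + p l * c) * hn l

/-- If every translate stayed in the orbit, `K` would contain `1 + x` for all `x` in the minimal
ideal. As `k + x = k * (1 + k⁻¹ * x)`, this non-zero ideal would then stabilise `K`, contradicting
purity. -/
theorem exists_socle_add_notMem (h : GaloisDecomposition p e) {K : Subgroup Rˣ}
    (hK : IsPureSubgroup K) {r : R} (hr : ∀ i, e i * r ≠ 0) {i : ι}
    (hi : p i * (e i * r) ≠ 0) :
    ∃ x ∈ socle (p i) (e i), ∀ k ∈ K, (k : R) * r ≠ r + x := by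
  by_contra! hcon
  have hone := fun x hx => h.exists_mem_eq_one_add (x := x) hr hi hcon hx
  let I : Ideal R :=
    { carrier := socle (p i) (e i)
      add_mem' := fun {x y} hx hy =>
        ⟨by linear_combination hx.1 + hy.1, by linear_combination hx.2 + hy.2⟩
      zero_mem' := ⟨by simp, by simp⟩
      smul_mem' := fun c x hx =>
        ⟨by simp only [smul_eq_mul]; linear_combination c * hx.1,
          by simp only [smul_eq_mul]; linear_combination c * hx.2⟩ }
  have hI : I ≤ lowerIdeal (Units.val '' (K : Set Rˣ)) := by
    refine le_sSup (Set.Subset.antisymm ?_ fun x hx => ⟨x, hx, 0, zero_mem _, add_zero x⟩)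
    rintro _ ⟨_, ⟨k, hk, rfl⟩, x, hx, rfl⟩
    obtain ⟨l, hl, hlx⟩ := hone (((k⁻¹ : Rˣ) : R) * x) (I.mul_mem_left _ hx)
    refine ⟨k * l, K.mul_mem hk hl, ?_⟩
    rw [Units.val_mul, hlx, mul_add, mul_one, Units.mul_inv_cancel_left]
  obtain ⟨x, hx, hx0⟩ := h.exists_socle_ne_zero i
  have : x ∈ lowerIdeal (Units.val '' (K : Set Rˣ)) := hI hx
  rw [hK.2] at this
  exact hx0 this

end GaloisDecomposition

/-- Raising the product to the power of all primes but `p i` isolates `y i`, and this exponent is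
coprime to `p i`. -/
theorem eq_one_of_prod_eq_one_of_pow_prime {Q : Type*} [CommGroup Q] {ι : Type*} [Fintype ι]
    {p : ι → ℕ} (hp : ∀ i, (p i).Prime) (hinj : Function.Injective p) {y : ι → Q}
    (hy : ∀ i, y i ^ p i = 1) (hprod : ∏ i, y i = 1) (i : ι) : y i = 1 := by
  classical
  set N := ∏ j ∈ Finset.univ.erase i, p j with hN
  have hcop : (p i).Coprime N := Nat.Coprime.prod_right fun j hj =>
    (Nat.coprime_primes (hp i) (hp j)).2 (hinj.ne (Finset.ne_of_mem_erase hj).symm)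
  have h1 : y i ^ N = 1 := by
    rw [← one_pow N, ← hprod, ← Finset.prod_pow, Finset.prod_eq_single i]
    · intro j _ hj
      obtain ⟨m, hm⟩ : p j ∣ N :=
        Finset.dvd_prod_of_mem _ (Finset.mem_erase.2 ⟨hj, Finset.mem_univ _⟩)
      rw [hm, pow_mul, hy, one_pow]
    · simp
  have := pow_gcd_eq_one.2 ⟨hy i, h1⟩
  rwa [Nat.coprime_iff_gcd_eq_one.1 hcop, pow_one] at this

/-! ### Fourier transform -/

section Fourier

variable {R : Type*} [CommRing R] [Fintype R]

/-- The Fourier transform on `R`, the characters of `R` being indexed by the elements of `R` by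
means of a fixed primitive character. -/
noncomputable def charTransform (χ : AddChar R ℂ) (f : R → ℂ) (a : R) : ℂ := ∑ x, f x * χ (a * x)

/-- The convolution of complex functions on `R`. -/
noncomputable def convolution (f g : R → ℂ) (z : R) : ℂ := ∑ x, f x * g (z - x)

theorem charTransform_convolution (χ : AddChar R ℂ) (f g : R → ℂ) (a : R) :
    charTransform χ (convolution f g) a = charTransform χ f a * charTransform χ g a := by
  simp only [charTransform, convolution, Finset.sum_mul]
  rw [Finset.sum_comm]
  refine Finset.sum_congr rfl fun x _ => ?_
  rw [Finset.mul_sum, ← Equiv.sum_comp (Equiv.addRight x)]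
  refine Finset.sum_congr rfl fun y _ => ?_
  rw [Equiv.coe_addRight, add_sub_cancel_right, mul_add, AddChar.map_add_eq_mul]
  ring

theorem charTransform_charTransform {χ : AddChar R ℂ} (hχ : χ.IsPrimitive) (f : R → ℂ) (z : R) :
    charTransform χ (charTransform χ f) z = Fintype.card R * f (-z) := by
  classical
  simp only [charTransform, Finset.sum_mul]
  rw [Finset.sum_comm, Finset.sum_eq_single (-z)]
  · simp only [mul_assoc, ← AddChar.map_add_eq_mul]
    simp [mul_comm]
  · intro x _ hx
    have h1 : ∀ y : R, f x * χ (y * x) * χ (z * y) = f x * χ (y * (x + z)) := fun y => by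
      rw [mul_assoc, ← AddChar.map_add_eq_mul]
      congr 2
      ring
    simp only [h1]
    rw [← Finset.mul_sum, AddChar.sum_mulShift _ hχ, if_neg, Nat.cast_zero, mul_zero]
    exact fun h0 => hx (eq_neg_of_add_eq_zero_left h0)
  · simp

theorem charTransform_smul (χ : AddChar R ℂ) (f : R → ℂ) (u : Rˣ) (a : R) :
    charTransform χ f (u * a) = charTransform χ (fun x => f (((u⁻¹ : Rˣ) : R) * x)) a := by
  simp only [charTransform]
  rw [← Equiv.sum_comp u.mulLeft (fun x => f (((u⁻¹ : Rˣ) : R) * x) * χ (a * x))]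
  refine Finset.sum_congr rfl fun x _ => ?_
  rw [Units.mulLeft_apply, Units.inv_mul_cancel_left]
  congr 2
  ring

theorem AddChar.map_finset_sum_eq_prod {G M ι : Type*} [AddCommMonoid G] [CommMonoid M]
    (ψ : AddChar G M) (s : Finset ι) (f : ι → G) : ψ (∑ i ∈ s, f i) = ∏ i ∈ s, ψ (f i) := by
  classical
  induction s using Finset.induction_on with
  | empty => simp
  | insert i s hi ih => rw [Finset.sum_insert hi, Finset.prod_insert hi, map_add_eq_mul, ih]

/-- If the transform of `f` vanishes on the units, then the alternating sums of `f` over the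
cubes whose edges are in the minimal ideals vanish. -/
theorem GaloisDecomposition.sum_cube_eq_zero {ι : Type*} [Fintype ι] {p : ι → ℕ} {e : ι → R}
    (h : GaloisDecomposition p e) {χ : AddChar R ℂ} (hχ : χ.IsPrimitive) {f : R → ℂ}
    (hf : ∀ u : Rˣ, charTransform χ f u = 0) {s : ι → R} (hs : ∀ i, s i ∈ socle (p i) (e i))
    (z : R) : ∑ S : Finset ι, (-1) ^ S.card * f (z + ∑ i ∈ S, s i) = 0 := by
  classical
  have hcard : (Fintype.card R : ℂ) ≠ 0 := by
    exact_mod_cast Fintype.card_ne_zero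
  refine (_root_.mul_eq_zero.1 ?_).resolve_left hcard
  have h1 : ∀ y, (Fintype.card R : ℂ) * f y = ∑ a, charTransform χ f a * χ (-(y * a)) := fun y => by
    have := charTransform_charTransform hχ f (-y)
    rw [neg_neg] at this
    rw [← this]
    simp only [charTransform, neg_mul]
  rw [Finset.mul_sum]
  simp only [mul_left_comm (Fintype.card R : ℂ), h1, Finset.mul_sum]
  rw [Finset.sum_comm]
  refine Finset.sum_eq_zero fun a _ => ?_
  obtain ⟨u, rfl⟩ | ⟨i, hi⟩ := h.isUnit_or_socle a
  · simp [hf]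
  have h2 : ∀ S : Finset ι, (-1 : ℂ) ^ S.card *
      (charTransform χ f a * χ (-((z + ∑ i ∈ S, s i) * a))) =
      charTransform χ f a * χ (-(z * a)) * ∏ i ∈ S, -χ (-(s i * a)) := fun S => by
    rw [Finset.prod_neg, ← AddChar.map_finset_sum_eq_prod, Finset.sum_neg_distrib, ← Finset.sum_mul,
      add_mul, neg_add, AddChar.map_add_eq_mul]
    ring
  simp only [h2]
  rw [← Finset.mul_sum, ← Finset.powerset_univ, ← Finset.prod_one_add,
    Finset.prod_eq_zero (Finset.mem_univ i), mul_zero]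
  rw [mul_comm, hi _ (hs i), neg_zero, AddChar.map_zero_eq_one, add_neg_cancel]

end Fourier

/-! ### The rigidity of orbits -/

/-- Take the expression of `u` for all exponents 1, choose `i` in its index set, and compare with an
expression in which only the exponent at `i` becomes 2. Their `p i`-parts are `x i` and either `x i
^ 2` or 1; both cases force `x i = 1`. -/
theorem false_of_forall_exists_prod_pow_eq {Q : Type*} [CommGroup Q] {ι : Type*} [Fintype ι]
    {p : ι → ℕ} (hp : ∀ i, (p i).Prime) (hinj : Function.Injective p) {x : ι → Q}
    (hx : ∀ i, x i ^ p i = 1) {u : Q}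
    (key : ∀ t : ι → ℕ, (∀ i, t i = 1 ∨ t i = 2) → ∃ S : Finset ι, S.Nonempty ∧
      (∀ i ∈ S, x i ≠ 1) ∧ ∏ i ∈ S, x i ^ t i = u) : False := by
  classical
  obtain ⟨S, ⟨i, hi⟩, hS, hSu⟩ := key (fun _ => 1) fun _ => Or.inl rfl
  obtain ⟨T, -, -, hTu⟩ := key (fun j => if j = i then 2 else 1) fun j => by
    by_cases hj : j = i <;> simp [hj]
  have h2 := eq_one_of_prod_eq_one_of_pow_prime hp hinj
    (y := fun j => (if j ∈ S then x j ^ 1 else 1) *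
      (if j ∈ T then x j ^ (if j = i then 2 else 1) else 1)⁻¹)
    (fun j => by
      have hite : ∀ (q : Prop) [Decidable q] (m : ℕ), (if q then x j ^ m else 1) ^ p j = 1 := by
        intro q _ m
        split_ifs
        · rw [pow_right_comm, hx, one_pow]
        · exact one_pow _
      rw [mul_pow, inv_pow, hite, hite, inv_one, one_mul])
    (by
      rw [Finset.prod_mul_distrib, Finset.prod_inv_distrib, Finset.prod_ite_mem,
        Finset.prod_ite_mem, Finset.univ_inter, Finset.univ_inter, hSu, hTu, mul_inv_cancel]) i
  simp only [if_pos hi, if_true, pow_one] at h2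
  split_ifs at h2
  · rw [pow_two, mul_inv_rev, mul_inv_cancel_left, inv_eq_one] at h2
    exact hS i hi h2
  · rw [inv_one, mul_one] at h2
    exact hS i hi h2

/-- Let `φ` be supported by the orbit `L r`, where all components of `r` are non-zero and `L r` is
contained in `K r` for a pure group `K`. If the transform of `φ` takes equal values at `x` and `u x`
for all units `x`, then `u r` is in `L r`. -/
theorem GaloisDecomposition.mul_mem_orbit_of_charTransform_eq {R : Type*} [CommRing R] [Fintype R]
    {ι : Type*} [Fintype ι] {p : ι → ℕ} {e : ι → R}
    (h : GaloisDecomposition p e) {χ : AddChar R ℂ} (hχ : χ.IsPrimitive) {K L : Subgroup Rˣ}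
    (hK : IsPureSubgroup K) {r : R} (hr : ∀ i, e i * r ≠ 0)
    (hL : ∀ l ∈ L, ∃ k ∈ K, (k : R) * r = l * r) {φ : R → ℂ}
    (hφ : ∀ y, φ y ≠ 0 ↔ ∃ l ∈ L, (l : R) * r = y) {u : Rˣ}
    (hu : ∀ x : Rˣ, charTransform χ φ x = charTransform χ φ (u * x)) :
    ∃ l ∈ L, (l : R) * r = u * r := by
  classical
  -- Including the stabiliser of `r` makes membership of `v` in `D` depend only on `v * r`: it means
  -- `v * r ∈ L r`.
  set D : Subgroup Rˣ := L ⊔ MulAction.stabilizer Rˣ r with hD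
  have memD : ∀ v : Rˣ, v ∈ D ↔ ∃ l ∈ L, (l : R) * r = v * r := by
    intro v
    rw [hD, Subgroup.mem_sup]
    constructor
    · rintro ⟨l, hl, t, ht, rfl⟩
      refine ⟨l, hl, ?_⟩
      have ht' : (t : R) * r = r := ht
      rw [Units.val_mul, mul_assoc, ht']
    · rintro ⟨l, hl, hlv⟩
      refine ⟨l, hl, l⁻¹ * v, ?_, mul_inv_cancel_left _ _⟩
      change ((l⁻¹ * v : Rˣ) : R) * r = r
      rw [Units.val_mul, mul_assoc, ← hlv, Units.inv_mul_cancel_left]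
  rw [← memD]
  by_contra huD
  -- the function with vanishing transform at the units
  set F : R → ℂ := fun y => φ y - φ (((u⁻¹ : Rˣ) : R) * y) with hF
  have hFt : ∀ x : Rˣ, charTransform χ F x = 0 := by
    intro x
    have h1 := charTransform_smul χ φ u x
    rw [← hu x] at h1
    have h2 : charTransform χ F x = charTransform χ φ x -
        charTransform χ (fun y => φ (((u⁻¹ : Rˣ) : R) * y)) x := by
      simp only [charTransform, hF, sub_mul, Finset.sum_sub_distrib]
    rw [h2, ← h1, sub_self]
  have hφD : ∀ v : Rˣ, φ (v * r) ≠ 0 ↔ v ∈ D := fun v => by rw [hφ, memD]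
  have hFD : ∀ v : Rˣ, F (v * r) ≠ 0 → v ∈ D ∨ u⁻¹ * v ∈ D := by
    intro v hv
    by_contra! hcon
    refine hv ?_
    have h1 := not_not.1 (mt (hφD v).1 hcon.1)
    have h2 := not_not.1 (mt (hφD (u⁻¹ * v)).1 hcon.2)
    rw [Units.val_mul, mul_assoc] at h2
    simp only [hF, h1, h2, sub_self]
  have hFr : F r ≠ 0 := by
    have h1 := (hφD 1).2 (one_mem _)
    have h2 := not_not.1 (mt (hφD u⁻¹).1 (mt (inv_mem_iff (H := D)).1 huD))
    rw [Units.val_one, one_mul] at h1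
    simpa only [hF, h2, sub_zero] using h1
  have hFunit : ∀ y, F y ≠ 0 → ∃ v : Rˣ, (v : R) * r = y := by
    intro y hy
    by_cases h1 : φ y = 0
    · have h2 : φ (((u⁻¹ : Rˣ) : R) * y) ≠ 0 := fun h2 => hy (by simp only [hF, h1, h2, sub_self])
      obtain ⟨l, -, hl⟩ := (hφ _).1 h2
      exact ⟨u * l, by rw [Units.val_mul, mul_assoc, hl, Units.mul_inv_cancel_left]⟩
    · obtain ⟨l, -, hl⟩ := (hφ _).1 h1
      exact ⟨l, hl⟩
  -- the edges of the cube
  have hedge : ∀ i, ∃ s ∈ socle (p i) (e i), ∃ v : Rˣ,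
      (p i * (e i * r) = 0 → s = -(e i * r) ∧ v = 1) ∧
      (p i * (e i * r) ≠ 0 → v ∉ D ∧ (v : R) * r = r + s ∧
        ∀ j, ∀ t ∈ socle (p j) (e j), (v : R) * t = t) := by
    intro i
    -- A component of `r` inside the minimal ideal is cancelled by its edge. For any other, purity
    -- gives an edge `s` with `r + s` outside `K r`, written as `v * r` with `v = 1 + p * c` fixing
    -- all the minimal ideals.
    by_cases hi : p i * (e i * r) = 0
    · refine ⟨-(e i * r), ⟨?_, by rw [mul_neg, hi, neg_zero]⟩, 1, by simp, fun h1 => absurd hi h1⟩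
      linear_combination (-r) * h.idem i
    · obtain ⟨s, hs, hsK⟩ := h.exists_socle_add_notMem hK hr hi
      obtain ⟨c, hc, hec⟩ := h.exists_mul_eq_of_mem_socle (r := p i * r) hs
        (by rwa [mul_left_comm])
      obtain ⟨n, hn⟩ := h.exists_pow_mul i
      have hnil : IsNilpotent ((p i : R) * c) := by
        refine ⟨n + 1, ?_⟩
        rw [pow_succ, mul_pow]
        linear_combination (-(p i : R) ^ n * c ^ n * p i) * hec + c ^ n * p i * c * hn
      obtain ⟨v, hv⟩ := hnil.isUnit_one_add
      have hvr : (v : R) * r = r + s := by rw [hv]; linear_combination hc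
      refine ⟨s, hs, v, fun h1 => absurd h1 hi, fun _ => ⟨?_, hvr, ?_⟩⟩
      · rw [memD]
        rintro ⟨l, hl, hlv⟩
        obtain ⟨k, hk, hkl⟩ := hL l hl
        exact hsK k hk (by rw [hkl, hlv, hvr])
      · intro j t ht
        obtain rfl | hij := eq_or_ne i j
        · rw [hv]; linear_combination c * ht.2
        · have := h.mul_socle_eq_zero hij.symm ht
          rw [hv]; linear_combination (p i : R) * c * this - (p i : R) * t * hec
  choose s hs v hshort hlong using hedge
  have hvt : ∀ i j, ∀ t ∈ socle (p j) (e j), (v i : R) * t = t := by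
    intro i j t ht
    by_cases hi : p i * (e i * r) = 0
    · rw [(hshort i hi).2, Units.val_one, one_mul]
    · exact (hlong i hi).2.2 j t ht
  have hvpow : ∀ i, p i * (e i * r) ≠ 0 → ∀ m : ℕ, (v i : R) ^ m * r = r + m * s i := by
    intro i hi m
    induction m with
    | zero => simp
    | succ m ih =>
      rw [pow_succ', mul_assoc, ih]
      push_cast
      linear_combination (hlong i hi).2.1 + (m : R) * hvt i i _ (hs i)
  set x : ι → Rˣ ⧸ D := fun i => (v i : Rˣ ⧸ D) with hx
  have hxp : ∀ i, x i ^ p i = 1 := by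
    intro i
    rw [hx]
    change ((v i ^ p i : Rˣ) : Rˣ ⧸ D) = 1
    rw [QuotientGroup.eq_one_iff, memD]
    refine ⟨1, one_mem _, ?_⟩
    by_cases hi : p i * (e i * r) = 0
    · rw [(hshort i hi).2, one_pow]
    · rw [Units.val_pow_eq_pow_val, hvpow i hi, (hs i).2, add_zero, Units.val_one, one_mul]
  have hx1 : ∀ i, p i * (e i * r) ≠ 0 → x i ≠ 1 := fun i hi =>
    mt (QuotientGroup.eq_one_iff _).1 (hlong i hi).1
  have hx2 : ∀ i, p i * (e i * r) ≠ 0 → x i ^ 2 ≠ 1 := by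
    intro i hi h2
    have := pow_gcd_eq_one.2 ⟨hxp i, h2⟩
    rw [Nat.coprime_iff_gcd_eq_one.1 ((Nat.coprime_two_right).2 (h.odd i)), pow_one] at this
    exact hx1 i hi this
  have key : ∀ t : ι → ℕ, (∀ i, t i = 1 ∨ t i = 2) → ∃ S : Finset ι, S.Nonempty ∧
      (∀ i ∈ S, p i * (e i * r) ≠ 0) ∧ ∏ i ∈ S, x i ^ t i = (u : Rˣ ⧸ D) := by
    intro t ht
    -- Only edges of the second kind are scaled; the cancelling edges must remain exact.
    set s' : ι → R := fun i => if p i * (e i * r) = 0 then s i else t i * s i with hs'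
    have hs'' : ∀ i, s' i ∈ socle (p i) (e i) := by
      intro i
      simp only [hs']
      split_ifs
      · exact hs i
      · exact ⟨by linear_combination (t i : R) * (hs i).1,
          by linear_combination (t i : R) * (hs i).2⟩
    have hsum := h.sum_cube_eq_zero hχ hFt hs'' r
    obtain ⟨S, hS, hFS⟩ : ∃ S : Finset ι, S.Nonempty ∧ F (r + ∑ i ∈ S, s' i) ≠ 0 := by
      by_contra! hcon
      rw [Finset.sum_eq_single ∅] at hsum
      · simp only [Finset.card_empty, pow_zero, Finset.sum_empty, add_zero, one_mul] at hsum
        exact hFr hsum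
      · intro S _ hS
        rw [hcon S (Finset.nonempty_iff_ne_empty.2 hS), mul_zero]
      · simp
    -- A cancelling edge would make a component of the vertex zero, whereas `F` lives on unit
    -- multiples of `r`, all of whose components are non-zero.
    have hSlong : ∀ i ∈ S, p i * (e i * r) ≠ 0 := by
      intro i hi h0
      obtain ⟨w, hw⟩ := hFunit _ hFS
      have h1 : e i * ∑ j ∈ S, s' j = -(e i * r) := by
        rw [Finset.mul_sum, Finset.sum_eq_single_of_mem i hi]
        · rw [(hs'' i).1]
          simp only [hs', if_pos h0]
          exact (hshort i h0).1
        · intro j _ hj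
          exact h.mul_socle_eq_zero hj (hs'' j)
      refine hr i ?_
      have h2 : (w : R) * (e i * r) = 0 := by linear_combination e i * hw + h1
      exact (w.mul_right_eq_zero).1 h2
    have hprod : ∀ T ⊆ S, ((∏ i ∈ T, v i ^ t i : Rˣ) : R) * r = r + ∑ i ∈ T, s' i := by
      intro T
      induction T using Finset.induction_on with
      | empty => simp
      | insert i T hiT ih =>
        intro hTS
        have hi := hSlong i (hTS (Finset.mem_insert_self i T))
        have hfix : ∀ m : ℕ, ∀ j ∈ T, (v i : R) ^ m * s' j = s' j := by
          intro m j _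
          induction m with
          | zero => simp
          | succ m ihm => rw [pow_succ, mul_assoc, hvt i j _ (hs'' j), ihm]
        rw [Finset.prod_insert hiT, Finset.sum_insert hiT, Units.val_mul, mul_assoc,
          ih fun j hj => hTS (Finset.mem_insert_of_mem hj), mul_add, Finset.mul_sum,
          Units.val_pow_eq_pow_val, Finset.sum_congr rfl (hfix (t i)), hvpow i hi]
        simp only [hs', if_neg hi, add_assoc]
    rw [← hprod S subset_rfl] at hFS
    have hmk : ((∏ i ∈ S, v i ^ t i : Rˣ) : Rˣ ⧸ D) = ∏ i ∈ S, x i ^ t i := by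
      rw [← QuotientGroup.mk'_apply, map_prod]
      simp only [map_pow, QuotientGroup.mk'_apply, hx]
    refine ⟨S, hS, hSlong, ?_⟩
    -- A vertex in `L r` would give a trivial product in the quotient, hence trivial factors; this
    -- is excluded, also for exponent 2, since the primes are odd. So the vertex lies in `u L r`.
    obtain h1 | h1 := hFD _ hFS
    · exfalso
      rw [← QuotientGroup.eq_one_iff, hmk] at h1
      obtain ⟨i, hi⟩ := hS
      have h2 := eq_one_of_prod_eq_one_of_pow_prime h.prime h.injective
        (y := fun i => if i ∈ S then x i ^ t i else 1)
        (fun i => by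
          split_ifs
          · rw [pow_right_comm, hxp, one_pow]
          · exact one_pow _)
        (by simpa [Finset.prod_ite_mem] using h1) i
      simp only [if_pos hi] at h2
      obtain h3 | h3 := ht i
      · rw [h3, pow_one] at h2
        exact hx1 i (hSlong i hi) h2
      · rw [h3] at h2
        exact hx2 i (hSlong i hi) h2
    · rw [← hmk]
      exact (QuotientGroup.eq.2 h1).symm
  exact false_of_forall_exists_prod_pow_eq h.prime h.injective hxp fun t ht => by
    obtain ⟨S, hS, hSlong, hSu⟩ := key t ht
    exact ⟨S, hS, fun i hi => hx1 i (hSlong i hi), hSu⟩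

/-! ### Basic sets and class functions of an S-ring -/

namespace SchurRing

section Group

variable {G : Type*} [AddGroup G] [Finite G] (A : SchurRing G)

/-- Two elements are related if they are in the same basic set. -/
def Rel (x y : G) : Prop := ∃ X ∈ A.basicSets, x ∈ X ∧ y ∈ X

theorem exists_basicSet_mem (x : G) : ∃ X ∈ A.basicSets, x ∈ X := by
  have : x ∈ ⋃₀ A.basicSets := A.sUnion_basicSets ▸ Set.mem_univ x
  exact this

variable {A}

theorem eq_of_mem_basicSets {X Y : Set G} (hX : X ∈ A.basicSets) (hY : Y ∈ A.basicSets) {x : G}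
    (hxX : x ∈ X) (hxY : x ∈ Y) : X = Y := by
  by_contra hne
  exact Set.disjoint_left.1 (A.pairwiseDisjoint hX hY hne) hxX hxY

theorem rel_iff_of_mem {X : Set G} (hX : X ∈ A.basicSets) {x y : G} (hx : x ∈ X) :
    A.Rel x y ↔ y ∈ X := by
  refine ⟨?_, fun hy => ⟨X, hX, hx, hy⟩⟩
  rintro ⟨Y, hY, hxY, hyY⟩
  rwa [eq_of_mem_basicSets hX hY hx hxY]

variable (A) in
theorem Rel.refl (x : G) : A.Rel x x := by
  obtain ⟨X, hX, hx⟩ := A.exists_basicSet_mem x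
  exact ⟨X, hX, hx, hx⟩

theorem Rel.symm {x y : G} : A.Rel x y → A.Rel y x := fun ⟨X, hX, hx, hy⟩ => ⟨X, hX, hy, hx⟩

theorem Rel.trans {x y z : G} : A.Rel x y → A.Rel y z → A.Rel x z := fun ⟨X, hX, hx, hy⟩ h =>
  ⟨X, hX, hx, (rel_iff_of_mem hX hy).1 h⟩

theorem IsASet.mem_of_rel {X : Set G} (hX : A.IsASet X) {x y : G} (h : A.Rel x y) (hx : x ∈ X) :
    y ∈ X := by
  obtain ⟨T, hT, rfl⟩ := hX
  obtain ⟨Y, hY, hxY⟩ := hx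
  exact ⟨Y, hY, (rel_iff_of_mem (hT hY) hxY).1 h⟩

variable (A) in
/-- A complex function is a class function of `A` if it is constant on the basic sets. -/
def IsClassFun (f : G → ℂ) : Prop := ∀ x y, A.Rel x y → f x = f y

theorem isClassFun_indicator {X : Set G} (hX : ∀ x y, A.Rel x y → x ∈ X → y ∈ X) :
    A.IsClassFun (X.indicator 1) := by
  intro x y hxy
  by_cases hx : x ∈ X
  · rw [Set.indicator_of_mem hx, Set.indicator_of_mem (hX x y hxy hx), Pi.one_apply, Pi.one_apply]
  · rw [Set.indicator_of_notMem hx,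
      Set.indicator_of_notMem fun hy => hx (hX y x hxy.symm hy)]

theorem isClassFun_coeff {a : AddMonoidAlgebra ℤ G} (ha : a ∈ A.carrier) :
    A.IsClassFun fun z => (a.coeff z : ℂ) := by
  classical
  rw [← A.span_eq, SetLike.mem_coe] at ha
  intro x y hxy
  simp only [Int.cast_inj]
  induction ha using Submodule.span_induction with
  | mem a h =>
    obtain ⟨X, hX, rfl⟩ := h
    have hiff : x ∈ X ↔ y ∈ X :=
      ⟨fun hx => (rel_iff_of_mem hX hx).1 hxy, fun hy => (rel_iff_of_mem hX hy).1 hxy.symm⟩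
    simp only [coeff_groupRingSum, hiff]
  | zero => simp
  | add a b _ _ h1 h2 => simp [h1, h2]
  | smul c a _ h => simp only [AddMonoidAlgebra.coeff_smul, Finsupp.smul_apply, h]

theorem groupRingSum_mem {X : Set G} (hX : X ∈ A.basicSets) : groupRingSum X ∈ A.carrier := by
  rw [← A.span_eq]
  exact Submodule.subset_span ⟨X, hX, rfl⟩

variable (A) in
/-- A class function is a linear combination of the indicator functions of the basic sets. -/
theorem IsClassFun.exists_eq_sum {f : G → ℂ} (hf : A.IsClassFun f) :
    ∃ c : Set G → ℂ, ∀ x, f x = ∑ X ∈ (Set.toFinite A.basicSets).toFinset,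
      c X * X.indicator 1 x := by
  choose! r hr using A.nonempty_of_mem
  refine ⟨fun X => f (r X), fun x => ?_⟩
  obtain ⟨X, hX, hx⟩ := A.exists_basicSet_mem x
  rw [Finset.sum_eq_single_of_mem X ((Set.Finite.mem_toFinset _).2 hX)]
  · rw [Set.indicator_of_mem hx, Pi.one_apply, mul_one]
    exact hf _ _ ⟨X, hX, hx, hr X hX⟩
  · intro Y hY hne
    rw [Set.indicator_of_notMem, mul_zero]
    exact fun hxY => hne (eq_of_mem_basicSets ((Set.Finite.mem_toFinset _).1 hY) hX hxY hx)

end Group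

/-! ### Convolution, multipliers and duality for S-rings over rings -/

section Ring

variable {R : Type*} [CommRing R] [Fintype R] {A : SchurRing R}

theorem convolution_indicator (X Y : Set R) (z : R) :
    convolution (X.indicator 1) (Y.indicator 1) z =
      ((groupRingSum X * groupRingSum Y).coeff z : ℂ) := by
  classical
  rw [groupRingSum, Finset.sum_mul, AddMonoidAlgebra.coeff_sum, Finsupp.finsetSum_apply]
  simp only [AddMonoidAlgebra.coeff_single_mul_apply, coeff_groupRingSum, one_mul]
  push_cast
  rw [convolution, ← Finset.sum_subset (Finset.subset_univ (Set.toFinite X).toFinset)]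
  · refine Finset.sum_congr rfl fun x hx => ?_
    rw [Set.indicator_of_mem ((Set.Finite.mem_toFinset _).1 hx), Pi.one_apply, one_mul,
      Set.indicator_apply, neg_add_eq_sub, Pi.one_apply]
  · intro x _ hx
    rw [Set.indicator_of_notMem (fun h => hx ((Set.Finite.mem_toFinset _).2 h)), zero_mul]

theorem IsClassFun.convolution {f g : R → ℂ} (hf : A.IsClassFun f) (hg : A.IsClassFun g) :
    A.IsClassFun (convolution f g) := by
  obtain ⟨c, hc⟩ := IsClassFun.exists_eq_sum A hf
  obtain ⟨d, hd⟩ := IsClassFun.exists_eq_sum A hg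
  have key : ∀ z, _root_.convolution f g z = ∑ X ∈ (Set.toFinite A.basicSets).toFinset,
      ∑ Y ∈ (Set.toFinite A.basicSets).toFinset,
        c X * d Y * _root_.convolution (X.indicator 1) (Y.indicator 1) z := by
    intro z
    simp only [_root_.convolution, hc, hd, Finset.sum_mul_sum]
    rw [Finset.sum_comm]
    refine Finset.sum_congr rfl fun X _ => ?_
    rw [Finset.sum_comm]
    refine Finset.sum_congr rfl fun Y _ => ?_
    rw [Finset.mul_sum]
    refine Finset.sum_congr rfl fun x _ => ?_
    ring
  intro x y hxy
  rw [key, key]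
  refine Finset.sum_congr rfl fun X hX => Finset.sum_congr rfl fun Y hY => ?_
  rw [convolution_indicator, convolution_indicator]
  congr 1
  exact isClassFun_coeff (A.mul_mem' (groupRingSum_mem ((Set.Finite.mem_toFinset _).1 hX))
    (groupRingSum_mem ((Set.Finite.mem_toFinset _).1 hY))) x y hxy

theorem IsOverRing.rel_mul (hA : A.IsOverRing) (u : Rˣ) {x y : R} (h : A.Rel x y) :
    A.Rel (u * x) (u * y) := by
  obtain ⟨X, hX, hx, hy⟩ := h
  exact ⟨u • X, hA u X hX, ⟨x, hx, rfl⟩, ⟨y, hy, rfl⟩⟩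

theorem IsDense.mem_of_rel (hA : A.IsDense) (I : Ideal R) {x y : R} (h : A.Rel x y) (hx : x ∈ I) :
    y ∈ I :=
  (hA I).mem_of_rel h hx

/-- Convolving the indicators of the basic set of `x` and of `J` gives a class function whose value
at `z` counts the `y` in that basic set with `z - y ∈ J`. Being positive at `a`, it is positive at
`b`. -/
theorem IsDense.rel_exists_sub_mem (hA : A.IsDense) (J : Ideal R) {a b x : R} (h : A.Rel a b)
    (hx : a - x ∈ J) : ∃ y, A.Rel x y ∧ b - y ∈ J := by
  classical
  have hc := (isClassFun_indicator (A := A) (X := {z | A.Rel x z})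
    fun y z hyz (hy : A.Rel x y) => hy.trans hyz).convolution
      (isClassFun_indicator fun y z hyz => hA.mem_of_rel J hyz) a b h
  have hval : ∀ z, convolution ({z | A.Rel x z}.indicator 1) ((J : Set R).indicator 1) z =
      ((Finset.univ.filter fun y => A.Rel x y ∧ z - y ∈ J).card : ℂ) := by
    intro z
    rw [convolution, Finset.card_filter]
    push_cast
    refine Finset.sum_congr rfl fun y _ => ?_
    simp only [Set.indicator_apply, Set.mem_ofPred_eq, SetLike.mem_coe, Pi.one_apply]
    split_ifs <;> simp_all
  rw [hval, hval, Nat.cast_inj] at hc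
  have hpos : 0 < (Finset.univ.filter fun y => A.Rel x y ∧ b - y ∈ J).card := by
    rw [← hc]
    exact Finset.card_pos.2 ⟨x, Finset.mem_filter.2 ⟨Finset.mem_univ _, Rel.refl A x, hx⟩⟩
  obtain ⟨y, hy⟩ := Finset.card_pos.1 hpos
  exact ⟨y, (Finset.mem_filter.1 hy).2⟩

/-- The group of the units `u` such that `r` and `u r` are in the same basic set. -/
def multipliers (hA : A.IsOverRing) (r : R) : Subgroup Rˣ where
  carrier := {u | A.Rel r (u * r)}
  one_mem' := by simpa using Rel.refl A r
  mul_mem' := by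
    intro u v (hu : A.Rel _ _) (hv : A.Rel _ _)
    have := hu.trans (hA.rel_mul u hv)
    rwa [← mul_assoc, ← Units.val_mul] at this
  inv_mem' := by
    intro u (hu : A.Rel _ _)
    have := hA.rel_mul u⁻¹ hu.symm
    rwa [Units.inv_mul_cancel_left] at this

theorem mem_multipliers (hA : A.IsOverRing) {r : R} {u : Rˣ} :
    u ∈ multipliers hA r ↔ A.Rel r (u * r) := Iff.rfl

variable (A) in
/-- Two elements are dually related if the transforms of the class functions do not separate
them. -/
def DualRel (χ : AddChar R ℂ) (a b : R) : Prop :=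
  ∀ f, A.IsClassFun f → charTransform χ f a = charTransform χ f b

theorem IsOverRing.dualRel_mul (hA : A.IsOverRing) {χ : AddChar R ℂ} (u : Rˣ) {a b : R}
    (h : A.DualRel χ a b) : A.DualRel χ (u * a) (u * b) := by
  intro f hf
  rw [charTransform_smul, charTransform_smul]
  exact h _ fun x y hxy => hf _ _ (hA.rel_mul u⁻¹ hxy)

/-- The group of the units that are dually related to the identity. -/
def dualMultipliers (hA : A.IsOverRing) (χ : AddChar R ℂ) : Subgroup Rˣ where
  carrier := {u | A.DualRel χ 1 u}
  one_mem' := fun f _ => by rw [Units.val_one]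
  mul_mem' := by
    intro u v (hu : A.DualRel _ _ _) (hv : A.DualRel _ _ _) f hf
    have := hA.dualRel_mul u hv f hf
    rw [mul_one] at this
    rw [hu f hf, this, Units.val_mul]
  inv_mem' := by
    intro u (hu : A.DualRel _ _ _) f hf
    have := hA.dualRel_mul u⁻¹ hu f hf
    rwa [mul_one, Units.inv_mul, eq_comm] at this

theorem mem_dualMultipliers (hA : A.IsOverRing) {χ : AddChar R ℂ} {u : Rˣ} :
    u ∈ dualMultipliers hA χ ↔ A.DualRel χ 1 u := Iff.rfl

theorem charTransform_add (χ : AddChar R ℂ) (f g : R → ℂ) :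
    charTransform χ (f + g) = charTransform χ f + charTransform χ g := by
  funext a
  simp only [charTransform, Pi.add_apply, add_mul, Finset.sum_add_distrib]

theorem charTransform_indicator_zero (χ : AddChar R ℂ) (c : ℂ) :
    charTransform χ (fun x => c * ({0} : Set R).indicator 1 x) = fun _ => c := by
  funext a
  rw [charTransform, Finset.sum_eq_single 0]
  · simp
  · intro x _ hx
    simp [hx]
  · simp

variable (A) in
/-- The algebra of the transforms of the class functions. -/
noncomputable def dualAlgebra (χ : AddChar R ℂ) : Subalgebra ℂ (R → ℂ) where
  carrier := {F | ∃ g, A.IsClassFun g ∧ charTransform χ g = F}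
  mul_mem' := by
    rintro _ _ ⟨f, hf, rfl⟩ ⟨g, hg, rfl⟩
    exact ⟨convolution f g, hf.convolution hg, funext fun a => charTransform_convolution χ f g a⟩
  add_mem' := by
    rintro _ _ ⟨f, hf, rfl⟩ ⟨g, hg, rfl⟩
    exact ⟨f + g, fun x y hxy => congrArg₂ (· + ·) (hf x y hxy) (hg x y hxy),
      charTransform_add χ f g⟩
  algebraMap_mem' := by
    intro c
    refine ⟨_, fun x y hxy => ?_, charTransform_indicator_zero χ c⟩
    congr 1
    exact isClassFun_indicator (fun x y h hx => by
      rwa [← rel_iff_of_mem A.zero_mem_basicSets hx]) x y hxy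

/-- The indicator functions of the classes of dually related elements are in the dual algebra. -/
theorem indicator_dualRel_mem_dualAlgebra (χ : AddChar R ℂ) (a : R) :
    {b | A.DualRel χ a b}.indicator 1 ∈ A.dualAlgebra χ := by
  classical
  have hsep : ∀ b, ¬ A.DualRel χ a b → ∃ F ∈ A.dualAlgebra χ, F a ≠ F b := by
    intro b hb
    rw [DualRel] at hb
    push Not at hb
    obtain ⟨f, hf, hne⟩ := hb
    exact ⟨_, ⟨f, hf, rfl⟩, hne⟩
  choose! F hF hne using hsep
  -- Lagrange interpolation: each factor is 1 on the class of `a` and vanishes at its own `b`.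
  have hmem : ∏ b ∈ Finset.univ.filter (fun b => ¬ A.DualRel χ a b),
      ((F b a - F b b)⁻¹ • (F b - algebraMap ℂ (R → ℂ) (F b b))) ∈ A.dualAlgebra χ :=
    Subalgebra.prod_mem _ fun b hb => Subalgebra.smul_mem _ (Subalgebra.sub_mem _
      (hF b (Finset.mem_filter.1 hb).2) (Subalgebra.algebraMap_mem _ _)) _
  convert hmem using 1
  funext c
  rw [Finset.prod_apply]
  simp only [Pi.smul_apply, Pi.sub_apply, Pi.algebraMap_apply, Algebra.algebraMap_self,
    RingHom.id_apply, smul_eq_mul]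
  by_cases hc : A.DualRel χ a c
  · rw [Set.indicator_of_mem (by exact hc), Pi.one_apply, eq_comm]
    refine Finset.prod_eq_one fun b hb => ?_
    have hb' := (Finset.mem_filter.1 hb).2
    obtain ⟨f, hf, hfF⟩ := hF b hb'
    rw [← hfF, ← hc f hf, hfF, inv_mul_cancel₀ (sub_ne_zero.2 (hne b hb'))]
  · rw [Set.indicator_of_notMem (by exact hc), eq_comm]
    refine Finset.prod_eq_zero (Finset.mem_filter.2 ⟨Finset.mem_univ c, hc⟩) ?_
    rw [sub_self, mul_zero]

end Ring

end SchurRing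

/-! ### The components of a CG-ring -/

/-- The identity of the `p`-component. -/
noncomputable def componentOne (R : Type*) [CommRing R] [Finite R] (p : ℕ) [Fact p.Prime] : R :=
  ((1 : pComponent R p) : R)

theorem mul_mem_pComponent {R : Type*} [CommRing R] {p : ℕ} {x : R} (hx : x ∈ pComponent R p) (y : R) : y * x ∈ pComponent R p := by
  obtain ⟨k, hk⟩ := hx
  exact ⟨k, by rw [← mul_smul_comm, hk, mul_zero]⟩

theorem mul_eq_zero_of_mem_pComponent {R : Type*} [CommRing R] {p q : ℕ} (hp : p.Prime) (hq : q.Prime) (hpq : p ≠ q) {x y : R}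
    (hx : x ∈ pComponent R p) (hy : y ∈ pComponent R q) : x * y = 0 := by
  obtain ⟨k, hk⟩ := hx
  obtain ⟨l, hl⟩ := hy
  rw [nsmul_eq_mul] at hk hl
  have hcop : IsCoprime ((p ^ k : ℕ) : ℤ) ((q ^ l : ℕ) : ℤ) :=
    Nat.isCoprime_iff_coprime.2 (Nat.Coprime.pow _ _ ((Nat.coprime_primes hp hq).2 hpq))
  obtain ⟨a, b, hab⟩ := hcop
  have habR : (a : R) * ((p ^ k : ℕ) : R) + b * ((q ^ l : ℕ) : R) = 1 := by
    exact_mod_cast congrArg (Int.cast : ℤ → R) hab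
  linear_combination (-(x * y)) * habR + a * y * hk + b * x * hl

section Component

variable {R : Type*} [CommRing R] [Finite R] {p : ℕ} [Fact p.Prime]

theorem componentOne_mem : componentOne R p ∈ pComponent R p := (1 : pComponent R p).2

theorem componentOne_mul {x : R} (hx : x ∈ pComponent R p) : componentOne R p * x = x :=
  congrArg Subtype.val (one_mul (⟨x, hx⟩ : pComponent R p))

theorem componentOne_mul_mem (y : R) : componentOne R p * y ∈ pComponent R p := by
  rw [mul_comm]
  exact mul_mem_pComponent componentOne_mem y

theorem exists_pow_mul_componentOne :
    ∃ n : ℕ, (p : R) ^ n * componentOne R p = 0 := by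
  obtain ⟨k, hk⟩ := componentOne_mem (R := R) (p := p)
  refine ⟨k, ?_⟩
  rw [← hk, nsmul_eq_mul, Nat.cast_pow]

theorem coe_natCast_pComponent (n : ℕ) :
    ((n : pComponent R p) : R) = n * componentOne R p := by
  induction n with
  | zero =>
    rw [Nat.cast_zero, Nat.cast_zero, zero_mul]
    rfl
  | succ n ih =>
    rw [Nat.cast_succ, Nat.cast_succ, add_mul, ← ih, one_mul]
    rfl

theorem IsGaloisRing.unit_or (h : IsGaloisRing (pComponent R p)) (x : R) :
    (∃ y, x * y * componentOne R p = componentOne R p) ∨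
      ∃ y, componentOne R p * x = p * y * componentOne R p := by
  obtain ⟨-, hloc, q, n, hq, hn, hchar, hjac⟩ := h
  -- The characteristic is a power of `q`, while some power of `p` annihilates the identity of the
  -- component.
  have hpq : q = p := by
    obtain ⟨k, hk⟩ := exists_pow_mul_componentOne (R := R) (p := p)
    have h0 : ((p ^ k : ℕ) : pComponent R p) = 0 := by
      refine Subtype.ext ?_
      rw [coe_natCast_pComponent, Nat.cast_pow, hk]
      rfl
    have h1 : q ∣ p ^ k :=
      (dvd_pow_self q (by omega)).trans (hchar ▸ ringChar.dvd h0)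
    exact (Nat.prime_dvd_prime_iff_eq hq Fact.out).1 (hq.dvd_of_dvd_pow h1)
  subst hpq
  rw [IsLocalRing.ringJacobson_eq_maximalIdeal] at hjac
  let x' : pComponent R q := ⟨componentOne R q * x, componentOne_mul_mem x⟩
  have hone : componentOne R q * componentOne R q = componentOne R q :=
    componentOne_mul componentOne_mem
  by_cases hx : IsUnit x'
  · obtain ⟨y, hy⟩ := hx.exists_right_inv
    have hy' : componentOne R q * x * (y : R) = componentOne R q := congrArg Subtype.val hy
    exact Or.inl ⟨y, by linear_combination hy'⟩
  · right
    have hx' : x' ∈ Ideal.span {(q : pComponent R q)} := by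
      rw [← hjac]
      exact (IsLocalRing.mem_maximalIdeal _).2 hx
    obtain ⟨y, hy⟩ := Ideal.mem_span_singleton.1 hx'
    have hy' : componentOne R q * x = ((q : pComponent R q) : R) * (y : R) :=
      congrArg Subtype.val hy
    rw [coe_natCast_pComponent] at hy'
    exact ⟨y, by linear_combination hy'⟩

theorem IsGaloisRing.componentOne_ne_zero (h : IsGaloisRing (pComponent R p)) :
    componentOne R p ≠ 0 := by
  obtain ⟨-, hloc, -⟩ := h
  intro h0
  exact one_ne_zero (α := pComponent R p) (Subtype.ext h0)

theorem odd_of_componentOne_ne_zero (h : componentOne R p ≠ 0) (hodd : Odd (ringChar R)) :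
    Odd p := by
  have hp : p.Prime := Fact.out
  obtain ⟨n, hn⟩ := exists_pow_mul_componentOne (R := R) (p := p)
  suffices hdvd : p ∣ ringChar R from hodd.of_dvd_nat hdvd
  by_contra hdvd
  have hcop : IsCoprime ((p ^ n : ℕ) : ℤ) (ringChar R : ℤ) :=
    Nat.isCoprime_iff_coprime.2 (Nat.Coprime.pow_left _ ((Nat.Prime.coprime_iff_not_dvd hp).2 hdvd))
  obtain ⟨a, b, hab⟩ := hcop
  have habR : (a : R) * (p : R) ^ n + b * (ringChar R : R) = 1 := by
    exact_mod_cast congrArg (Int.cast : ℤ → R) hab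
  have hc : (ringChar R : R) = 0 := ringChar.Nat.cast_ringChar
  refine h ?_
  linear_combination (-componentOne R p) * habR + a * hn + b * componentOne R p * hc

end Component

theorem IsCGRing.exists_galoisDecomposition {R : Type*} [CommRing R] [Finite R] (hR : IsCGRing R)
    (hodd : Odd (ringChar R)) :
    ∃ (ι : Type) (_ : Fintype ι) (p : ι → ℕ) (e : ι → R), GaloisDecomposition p e := by
  classical
  have hprime : ∀ i : {p // p ∈ (Nat.card R).primeFactors}, Fact (i : ℕ).Prime := fun i =>
    ⟨Nat.prime_of_mem_primeFactors i.2⟩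
  have hgal : ∀ i : {p // p ∈ (Nat.card R).primeFactors}, IsGaloisRing (pComponent R i) :=
    fun i => hR i (Nat.dvd_of_mem_primeFactors i.2)
  set e : {p // p ∈ (Nat.card R).primeFactors} → R := fun i => componentOne R i with he
  have hidem : ∀ i, e i * e i = e i := fun i => componentOne_mul componentOne_mem
  have horth : ∀ i j, i ≠ j → e i * e j = 0 := fun i j hij =>
    mul_eq_zero_of_mem_pComponent (hprime i).out (hprime j).out (fun h => hij (Subtype.ext h))
      componentOne_mem componentOne_mem
  -- This yields completeness of the idempotents: a non-zero `x` has a multiple of some prime order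
  -- `q`, which lies in the `q`-component and is fixed by its identity.
  have hzero : ∀ x : R, (∀ i, e i * x = 0) → x = 0 := by
    intro x hx
    by_contra hx0
    have hord : addOrderOf x ≠ 1 := fun h => hx0 (AddMonoid.addOrderOf_eq_one_iff.1 h)
    obtain ⟨q, hq, m, hm⟩ := Nat.exists_prime_and_dvd hord
    have hmx : m • x ≠ 0 := by
      refine nsmul_ne_zero_of_lt_addOrderOf ?_ ?_
      · rintro rfl
        exact (addOrderOf_pos x).ne' (by rw [hm, mul_zero])
      · have := addOrderOf_pos x
        have hmpos : 0 < m := Nat.pos_of_ne_zero (by rintro rfl; omega)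
        rw [hm]
        nlinarith [hq.two_le]
    have hqR : q ∈ (Nat.card R).primeFactors :=
      Nat.mem_primeFactors.2 ⟨hq,
      (Dvd.intro m hm.symm).trans (addOrderOf_dvd_natCard x), Nat.card_pos.ne'⟩
    have hmem : m • x ∈ pComponent R q := ⟨1, by
      rw [pow_one, smul_smul, ← hm, addOrderOf_nsmul_eq_zero]⟩
    refine hmx ?_
    have := hprime ⟨q, hqR⟩
    rw [← componentOne_mul hmem, mul_smul_comm]
    exact (congrArg (m • ·) (hx ⟨q, hqR⟩)).trans (smul_zero m)
  refine ⟨{p // p ∈ (Nat.card R).primeFactors}, inferInstance, fun i => i, e, ⟨⟨⟨hidem, fun i j hij => horth i j hij⟩, ?_⟩,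
    Subtype.val_injective, fun i => (hprime i).out,
    fun i => odd_of_componentOne_ne_zero (hgal i).componentOne_ne_zero hodd,
    fun i => (hgal i).componentOne_ne_zero, fun i => exists_pow_mul_componentOne,
    fun i => (hgal i).unit_or⟩⟩
  refine sub_eq_zero.1 (hzero _ fun i => ?_)
  rw [mul_sub, Finset.mul_sum, Finset.sum_eq_single i, hidem, mul_one, sub_self]
  · exact fun j _ hj => horth i j hj.symm
  · simp

/-! ### Dense pure S-rings are cyclotomic -/

theorem indicator_ne_zero_iff {R : Type*} [CommRing R] {X : Set R} {L : Subgroup Rˣ} {r : R}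
    (hX : ∀ y, y ∈ X ↔ ∃ l ∈ L, (l : R) * r = y) (y : R) :
    X.indicator (1 : R → ℂ) y ≠ 0 ↔ ∃ l ∈ L, (l : R) * r = y := by
  rw [← hX, Set.indicator_apply_ne_zero]
  simp

theorem mem_coe_image_iff {R : Type*} [CommRing R] (L : Subgroup Rˣ) (y : R) :
    y ∈ Units.val '' (L : Set Rˣ) ↔ ∃ l ∈ L, (l : R) * 1 = y := by
  simp

namespace SchurRing

variable {R : Type*} [CommRing R] [Fintype R] {A : SchurRing R}

theorem IsDense.isUnit_of_rel_one (hd : A.IsDense) {x : R} (h : A.Rel 1 x) : IsUnit x :=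
  isUnit_of_dvd_one (Ideal.mem_span_singleton.1
    (hd.mem_of_rel (Ideal.span {x}) h.symm (Ideal.mem_span_singleton_self x)))

theorem coe_multipliers_one (hA : A.IsOverRing) (hd : A.IsDense) :
    Units.val '' (multipliers hA 1 : Set Rˣ) = {x | A.Rel 1 x} := by
  ext x
  constructor
  · rintro ⟨u, hu, rfl⟩
    have := (mem_multipliers hA).1 hu
    rwa [mul_one] at this
  · intro hx
    obtain ⟨u, rfl⟩ := hd.isUnit_of_rel_one hx
    exact ⟨u, (mem_multipliers hA).2 (by rwa [mul_one]), rfl⟩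

theorem IsPure.isPureSubgroup (hp : A.IsPure) (hA : A.IsOverRing) (hd : A.IsDense) :
    IsPureSubgroup (multipliers hA 1) := by
  obtain ⟨X, hX, h1⟩ := A.exists_basicSet_mem 1
  have hXK : Units.val '' (multipliers hA 1 : Set Rˣ) = X := by
    rw [coe_multipliers_one hA hd]
    exact Set.ext fun x => rel_iff_of_mem hX h1
  rw [IsPureSubgroup, hXK]
  exact hp X hX ⟨1, h1⟩

/-! ### The dual class of the identity and the basic sets as orbits -/

variable {ι : Type*} [Fintype ι] {p : ι → ℕ} {e : ι → R} {χ : AddChar R ℂ}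

/-- A non-unit `a` kills a minimal ideal, hence some non-zero ideal `I`. The transform of the
indicator of `I`, a class function by density, is the cardinality of `I` at `a`, but 0 at 1 since a
primitive character is non-trivial on `I`. -/
theorem isUnit_of_dualRel_one (h : GaloisDecomposition p e) (hχ : χ.IsPrimitive) (hd : A.IsDense)
    {a : R} (ha : A.DualRel χ 1 a) : IsUnit a := by
  classical
  obtain hu | ⟨i, hi⟩ := h.isUnit_or_socle a
  · exact hu
  exfalso
  obtain ⟨y, hy, hy0⟩ := h.exists_socle_ne_zero i
  set I : Ideal R := Ideal.span {y} with hI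
  have hval := ha _ (isClassFun_indicator fun _ _ h => hd.mem_of_rel I h)
  have hsum : ∀ b : R, charTransform χ ((I : Set R).indicator 1) b =
      ∑ x ∈ Finset.univ.filter (· ∈ I), χ (b * x) := by
    intro b
    rw [charTransform, Finset.sum_filter]
    refine Finset.sum_congr rfl fun x _ => ?_
    simp only [Set.indicator_apply, SetLike.mem_coe, Pi.one_apply, ite_mul, one_mul, zero_mul]
  obtain ⟨c, hc⟩ : ∃ c, χ (y * c) ≠ 1 := by
    by_contra! hall
    exact hχ hy0 (DFunLike.ext _ _ hall)
  have hyc : y * c ∈ I := I.mul_mem_right c (Ideal.mem_span_singleton_self y)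
  have h1 : charTransform χ ((I : Set R).indicator 1) 1 = 0 := by
    rw [hsum]
    have hshift : ∑ x ∈ Finset.univ.filter (· ∈ I), χ (1 * x) =
        χ (y * c) * ∑ x ∈ Finset.univ.filter (· ∈ I), χ (1 * x) := by
      rw [Finset.mul_sum]
      refine Finset.sum_bij' (fun x _ => x - y * c) (fun x _ => x + y * c) ?_ ?_ ?_ ?_ ?_
      · exact fun x hx => Finset.mem_filter.2
          ⟨Finset.mem_univ _, I.sub_mem (Finset.mem_filter.1 hx).2 hyc⟩
      · exact fun x hx => Finset.mem_filter.2
          ⟨Finset.mem_univ _, I.add_mem (Finset.mem_filter.1 hx).2 hyc⟩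
      · exact fun x _ => sub_add_cancel _ _
      · exact fun x _ => add_sub_cancel_right _ _
      · intro x _
        rw [one_mul, one_mul, ← AddChar.map_add_eq_mul, add_sub_cancel]
    by_contra hne
    exact hc (mul_right_cancel₀ hne (by rw [← hshift, one_mul]))
  have h2 : charTransform χ ((I : Set R).indicator 1) a =
      ((Finset.univ.filter (· ∈ I)).card : ℂ) := by
    rw [hsum, Finset.card_eq_sum_ones]
    push_cast
    refine Finset.sum_congr rfl fun x hx => ?_
    obtain ⟨d, rfl⟩ := Ideal.mem_span_singleton.1 (Finset.mem_filter.1 hx).2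
    rw [← mul_assoc, hi y hy, zero_mul, AddChar.map_zero_eq_one]
  rw [h1, h2, eq_comm, Nat.cast_eq_zero, Finset.card_eq_zero] at hval
  exact Finset.notMem_empty (0 : R)
    (hval ▸ Finset.mem_filter.2 ⟨Finset.mem_univ _, I.zero_mem⟩)

theorem coe_dualMultipliers (h : GaloisDecomposition p e) (hχ : χ.IsPrimitive)
    (hA : A.IsOverRing) (hd : A.IsDense) :
    Units.val '' (dualMultipliers hA χ : Set Rˣ) = {x | A.DualRel χ 1 x} := by
  ext x
  constructor
  · rintro ⟨u, hu, rfl⟩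
    exact hu
  · intro hx
    obtain ⟨u, rfl⟩ := isUnit_of_dualRel_one h hχ hd hx
    exact ⟨u, hx, rfl⟩

theorem dualMultipliers_le (h : GaloisDecomposition p e) (hχ : χ.IsPrimitive)
    (hA : A.IsOverRing) (hd : A.IsDense) (hp : A.IsPure) :
    dualMultipliers hA χ ≤ multipliers hA 1 := by
  intro u hu
  obtain ⟨l, hl, hlu⟩ := h.mul_mem_orbit_of_charTransform_eq hχ (L := multipliers hA 1)
    (hp.isPureSubgroup hA hd) h.mul_one_ne_zero (fun l hl => ⟨l, hl, rfl⟩)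
    (indicator_ne_zero_iff (mem_coe_image_iff _)) (u := u) (fun x => by
      have hx := hA.dualRel_mul x hu
      rw [mul_one, mul_comm] at hx
      refine hx _ ?_
      rw [coe_multipliers_one hA hd]
      exact isClassFun_indicator fun y z hyz hy => hy.trans hyz)
  rw [mul_one, mul_one] at hlu
  rwa [← Units.ext hlu]

theorem exists_charTransform_eq_indicator (h : GaloisDecomposition p e) (hχ : χ.IsPrimitive)
    (hA : A.IsOverRing) (hd : A.IsDense) : ∃ g, A.IsClassFun g ∧ charTransform χ g =
      (Units.val '' (dualMultipliers hA χ : Set Rˣ)).indicator 1 := by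
  rw [coe_dualMultipliers h hχ hA hd]
  exact indicator_dualRel_mem_dualAlgebra χ 1

/-- The basic set of the identity coincides with that of the dual S-ring. -/
theorem dualMultipliers_eq (h : GaloisDecomposition p e) (hχ : χ.IsPrimitive)
    (hA : A.IsOverRing) (hd : A.IsDense) (hp : A.IsPure) :
    dualMultipliers hA χ = multipliers hA 1 := by
  refine le_antisymm (dualMultipliers_le h hχ hA hd hp) fun u hu => ?_
  obtain ⟨g, hg, hgi⟩ := exists_charTransform_eq_indicator h hχ hA hd
  obtain ⟨l, hl, hlu⟩ := h.mul_mem_orbit_of_charTransform_eq hχ (L := dualMultipliers hA χ)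
    (hp.isPureSubgroup hA hd) h.mul_one_ne_zero
    (fun l hl => ⟨l, dualMultipliers_le h hχ hA hd hp hl, rfl⟩)
    (indicator_ne_zero_iff (mem_coe_image_iff _)) (u := u) (fun x => by
      -- The indicator of the dual class is the transform of a class function `g`, so transforming
      -- again returns `g` at negated arguments.
      rw [← hgi, charTransform_charTransform hχ, charTransform_charTransform hχ]
      congr 1
      refine hg _ _ ?_
      have := hA.rel_mul (-x) ((mem_multipliers hA).1 hu)
      rw [Units.val_neg, mul_one, mul_one] at this
      rwa [mul_comm (u : R), ← neg_mul])
  rw [mul_one, mul_one] at hlu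
  rwa [← Units.ext hlu]

theorem multipliers_subset_orbit (h : GaloisDecomposition p e) (hχ : χ.IsPrimitive)
    (hA : A.IsOverRing) (hd : A.IsDense) (hp : A.IsPure) {r : R} (hr : ∀ i, e i * r ≠ 0) {u : Rˣ}
    (hu : A.Rel r (u * r)) : ∃ k ∈ multipliers hA 1, (k : R) * r = u * r := by
  classical
  obtain ⟨g, hg, hgi⟩ := exists_charTransform_eq_indicator h hχ hA hd
  rw [dualMultipliers_eq h hχ hA hd hp] at hgi
  set X := Units.val '' (multipliers hA 1 : Set Rˣ) with hX
  -- The push-forward must keep multiplicities: then its transform at `x` is that of the indicator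
  -- of `K` at `x * r`.
  have htr : ∀ x : R, charTransform χ
      (fun y => ∑ z, if z ∈ X ∧ z * r = y then (1 : ℂ) else 0) x =
        Fintype.card R * g (-(x * r)) := by
    intro x
    rw [← charTransform_charTransform hχ, hgi]
    simp only [charTransform, Finset.sum_mul]
    rw [Finset.sum_comm]
    refine Finset.sum_congr rfl fun z _ => ?_
    rw [Finset.sum_eq_single_of_mem (z * r) (Finset.mem_univ _)]
    · simp only [and_true, Set.indicator_apply, Pi.one_apply]
      congr 2
      ring
    · intro y _ hy
      rw [if_neg fun h => hy h.2.symm, zero_mul]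
  refine h.mul_mem_orbit_of_charTransform_eq hχ (L := multipliers hA 1)
    (hp.isPureSubgroup hA hd) hr (fun l hl => ⟨l, hl, rfl⟩)
    (φ := fun y => ∑ z, if z ∈ X ∧ z * r = y then (1 : ℂ) else 0) ?_ fun x => ?_
  · intro y
    rw [Finset.sum_boole, Nat.cast_ne_zero, Finset.card_ne_zero]
    constructor
    · rintro ⟨z, hz⟩
      obtain ⟨⟨l, hl, rfl⟩, hlr⟩ := (Finset.mem_filter.1 hz).2
      exact ⟨l, hl, hlr⟩
    · rintro ⟨l, hl, hlr⟩
      exact ⟨l, Finset.mem_filter.2 ⟨Finset.mem_univ _, ⟨l, hl, rfl⟩, hlr⟩⟩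
  · rw [htr, htr]
    congr 1
    refine hg _ _ ?_
    have := hA.rel_mul (-x) hu
    rw [Units.val_neg] at this
    convert this using 1 <;> ring

/-- The basic sets of the elements with non-zero components are orbits. -/
theorem rel_iff_of_component_ne_zero (h : GaloisDecomposition p e) (hχ : χ.IsPrimitive)
    (hA : A.IsOverRing) (hd : A.IsDense) (hp : A.IsPure) {r : R} (hr : ∀ i, e i * r ≠ 0) {y : R} :
    A.Rel r y ↔ ∃ k ∈ multipliers hA 1, (k : R) * r = y := by
  have hunit : ∀ y, A.Rel r y → ∃ u : Rˣ, (u : R) * r = y := by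
    intro y hy
    obtain ⟨a, ha⟩ := Ideal.mem_span_singleton'.1
      (hd.mem_of_rel (Ideal.span {r}) hy (Ideal.mem_span_singleton_self r))
    obtain ⟨b, hb⟩ := Ideal.mem_span_singleton'.1
      (hd.mem_of_rel (Ideal.span {y}) hy.symm (Ideal.mem_span_singleton_self y))
    -- Related elements generate the same ideal. If `a` killed a minimal ideal, then so would `a *
    -- b`; but `a * b` fixes `r`, a multiple of which is a non-zero element of that ideal.
    obtain ⟨u, rfl⟩ | ⟨i, hi⟩ := h.isUnit_or_socle a
    · exact ⟨u, ha⟩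
    · exfalso
      obtain ⟨s, hs, hs0⟩ := h.exists_socle_ne_zero i
      obtain ⟨c, hc, -⟩ := h.exists_mul_eq_of_mem_socle hs (hr i)
      refine hs0 ?_
      linear_combination (a * b - 1) * hc - c * hb - c * b * ha + b * hi s hs
  constructor
  · intro hy
    obtain ⟨u, rfl⟩ := hunit y hy
    exact multipliers_subset_orbit h hχ hA hd hp hr hy
  · rintro ⟨k, hk, rfl⟩
    obtain ⟨l, hl, hlk⟩ := h.mul_mem_orbit_of_charTransform_eq hχ (L := multipliers hA r)
      (hp.isPureSubgroup hA hd) hr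
      (fun l hl => multipliers_subset_orbit h hχ hA hd hp hr ((mem_multipliers hA).1 hl))
      (indicator_ne_zero_iff (X := {y | A.Rel r y}) fun y => by
        constructor
        · intro hy
          obtain ⟨u, rfl⟩ := hunit y hy
          exact ⟨u, hy, rfl⟩
        · rintro ⟨l, hl, rfl⟩
          exact hl) (u := k) (fun x => by
      rw [← dualMultipliers_eq h hχ hA hd hp] at hk
      have hx := hA.dualRel_mul x ((mem_dualMultipliers hA).1 hk)
      rw [mul_one, mul_comm] at hx
      exact hx _ (isClassFun_indicator fun y z hyz (hy : A.Rel r y) => hy.trans hyz))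
    rw [← hlk]
    exact (mem_multipliers hA).1 hl

/-- All the basic sets are orbits. -/
theorem rel_iff (h : GaloisDecomposition p e) (hA : A.IsOverRing) (hd : A.IsDense) (hp : A.IsPure)
    {r y : R} : A.Rel r y ↔ ∃ k ∈ multipliers hA 1, (k : R) * r = y := by
  classical
  obtain ⟨χ, hχ⟩ := h.exists_primitive_addChar
  -- `E` is the idempotent of the components where `r` is non-zero. Adding `1 - E` to `r` fills the
  -- other components, and the result is congruent to `r` modulo `J`.
  set E : R := ∑ i, e i * (if e i * r = 0 then 0 else 1) with hE
  have heE : ∀ i, e i * E = e i * (if e i * r = 0 then 0 else 1) := fun i => h.mul_sum _ i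
  have hEr : E * r = r := h.ext fun i => by
    rw [← mul_assoc, heE]
    split_ifs with h0
    · rw [mul_zero, zero_mul, h0]
    · rw [mul_one]
  have hEE : E * E = E := h.ext fun i => by
    rw [← mul_assoc, heE]
    split_ifs with h0
    · rw [mul_zero, zero_mul]
    · rw [mul_one, heE, if_neg h0, mul_one]
  set r' : R := r + (1 - E) with hr'
  have hr'0 : ∀ i, e i * r' ≠ 0 := by
    intro i
    rw [hr', mul_add, mul_sub, mul_one, heE]
    split_ifs with h0
    · rw [h0, mul_zero, sub_zero, zero_add]
      exact h.ne_zero i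
    · rwa [mul_one, sub_self, add_zero]
  have hEr' : E * r' = r := by linear_combination hEr - hEE
  set J : Ideal R := Ideal.span {1 - E} with hJ
  have hEJ : ∀ z ∈ J, E * z = 0 := by
    intro z hz
    obtain ⟨c, rfl⟩ := Ideal.mem_span_singleton.1 hz
    linear_combination -c * hEE
  have hEy : ∀ z, A.Rel r z → E * z = z := by
    intro z hz
    obtain ⟨c, rfl⟩ := Ideal.mem_span_singleton.1
      (hd.mem_of_rel (Ideal.span {r}) hz (Ideal.mem_span_singleton_self r))
    rw [← mul_assoc, hEr]
  have hrel := fun y => rel_iff_of_component_ne_zero (y := y) h hχ hA hd hp hr'0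
  constructor
  · intro hy
    obtain ⟨x, hx, hxJ⟩ := hd.rel_exists_sub_mem J (x := r') hy
      (by rw [Ideal.mem_span_singleton]; exact ⟨-1, by rw [hr']; ring⟩)
    obtain ⟨k, hk, rfl⟩ := (hrel x).1 hx
    exact ⟨k, hk, by linear_combination hEy y hy - hEJ _ hxJ - k * hEr'⟩
  · rintro ⟨k, hk, rfl⟩
    obtain ⟨x, hx, hxJ⟩ := hd.rel_exists_sub_mem J (x := r) ((hrel (k * r')).2 ⟨k, hk, rfl⟩)
      (by rw [Ideal.mem_span_singleton]; exact ⟨1, by rw [hr']; ring⟩)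
    have hxk : x = k * r := by linear_combination -hEy x hx - hEJ _ hxJ + k * hEr'
    rwa [← hxk]

theorem eq_of_basicSets_eq {G : Type*} [AddGroup G] [Finite G] {A B : SchurRing G}
    (h : A.basicSets = B.basicSets) : A = B := by
  have hc : A.toSubring = B.toSubring := by
    refine SetLike.coe_injective ?_
    change A.carrier = B.carrier
    rw [← A.span_eq, ← B.span_eq, h]
  cases A
  cases B
  simp only at h hc
  subst h hc
  rfl

end SchurRing

theorem mainTheorem7 {R : Type*} [CommRing R] [Finite R] (hR : IsCGRing R)
    (hodd : Odd (ringChar R)) (A : SchurRing R) (hA : A.IsOverRing) (hdense : A.IsDense)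
    (hpure : A.IsPure) :
    ∃ K : Subgroup Rˣ, IsPureSubgroup K ∧ A = cyc K := by
  have := Fintype.ofFinite R
  obtain ⟨ι, _, p, e, h⟩ := hR.exists_galoisDecomposition hodd
  refine ⟨SchurRing.multipliers hA 1, hpure.isPureSubgroup hA hdense,
    SchurRing.eq_of_basicSets_eq ?_⟩
  have horb : ∀ X ∈ A.basicSets, ∀ r ∈ X,
      MulAction.orbit (SchurRing.multipliers hA 1) r = X := by
    intro X hX r hr
    ext y
    rw [← SchurRing.rel_iff_of_mem hX hr, SchurRing.rel_iff h hA hdense hpure]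
    constructor
    · rintro ⟨k, rfl⟩
      exact ⟨k, k.2, rfl⟩
    · rintro ⟨k, hk, rfl⟩
      exact ⟨⟨k, hk⟩, rfl⟩
  ext X
  constructor
  · intro hX
    obtain ⟨r, hr⟩ := A.nonempty_of_mem X hX
    exact ⟨r, horb X hX r hr⟩
  · rintro ⟨r, rfl⟩
    obtain ⟨X, hX, hr⟩ := A.exists_basicSet_mem r
    change MulAction.orbit _ r ∈ A.basicSets
    rwa [horb X hX r hr]
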